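/- **Setting.** Fix $d$ and consider the linear regression models $\mathbf Y=\mathbf X\beta+\varepsilon$, $n=1,2,\dots$, where $\mathbf X=\mathbf X_n$ is a deterministic $n\times d$ matrix, $\beta\in\mathbb R^d$, ${\rm E}[\varepsilon]=0$, ${\rm Var}(\varepsilon)=\sigma^2I_n$ with $\sigma>0$, and $n^{-1}\mathbf X'\mathbf X\to\Sigma$ for a positive definite matrix $\Sigma$. Let $\hat\beta=(\mathbf X'\mathbf X)^{-1}\mathbf X'\mathbf Y$ be the least squares estimator (LSE). For $b\subset\{1,\dots,d\}$ with complement $\bar b$, write $x_b=(x_j)_{j\in b}$, $\mathbf X_b$ for the matrix of the columns of $\mathbf X$ with index in $b$, and $M_{bb'}=(m_{ij})_{i\in b,\,j\in b'}$ for the blocks of a matrix $M$. Let $c\in\mathbb R^d$ be a fixed vector, let $(a_{nj})_{1\le j\le d}$, $n\geq 1$, be real numbers with $\max_j a_{nj}\to0$ and $\sqrt n\min_j a_{nj}\to\infty$, and let $\hat V^{-1}$ be any consistent estimator of the matrix $V^{-1}=\sigma^2\Sigma^{-1}$, with inverse $\hat V$. Put $b_n=\{j:|\hat\beta_j-c_j|>a_{nj}\}$.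 The oracle Hodges' estimator $\tilde\beta(c)$ is defined by $$\tilde\beta_{b_n}(c)=\hat\beta_{b_n}+\hat V_{b_nb_n}^{-1}\hat V_{b_n\bar b_n}(\hat\beta_{\bar b_n}-c_{\bar b_n}),\qquad \tilde\beta_{\bar b_n}(c)=c_{\bar b_n},$$ so that $\tilde\beta(c)=\hat\beta$ if $b_n=\{1,\dots,d\}$ and $\tilde\beta(c)=c$ if $b_n=\emptyset$. Let $b(\beta)=\{j:\beta_j\ne c_j\}$. **Theorem.** (A) If, for every $n$, the components of $\varepsilon$ are independent, and the rows $x_{ni}'$ of $\mathbf X_n$ satisfy the Lindeberg condition $$\frac1n\sum_{i=1}^n\|x_{ni}\|^2\,{\rm E}\big[\varepsilon_{ni}^2\,I(\|x_{ni}\|\,|\varepsilon_{ni}|>\delta\sqrt n)\big]\to0\quad\text{for every }\delta>0,$$ then the LSE is asymptotically normal: $\sqrt n(\hat\beta-\beta)\overset{d}{\to}N(0,\sigma^2\Sigma^{-1})$. (B) Whenever $\sqrt n(\hat\beta-\beta)\overset{d}{\to}N(0,\sigma^2\Sigma^{-1})$, the following hold. 1. For every $b\subset\{1,\dots,d\}$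 with $\beta_{\bar b}=c_{\bar b}$, $\lim_{n\to\infty}\Pr(\tilde\beta_{\bar b}(c)=\beta_{\bar b})=1$. 2. With the coordinates arranged in the order $b(\beta),\bar b(\beta)$, $$\sqrt n(\tilde\beta(c)-\beta)\overset{d}{\to}N\left(0,\begin{pmatrix}\sigma^2\Sigma_{b(\beta)b(\beta)}^{-1}&0\\0&0\end{pmatrix}\right),\qquad \Sigma_{b(\beta)b(\beta)}=\lim_{n\to\infty}\frac1n\mathbf X_{b(\beta)}'\mathbf X_{b(\beta)}.$$ 3. $\sqrt n(\tilde\beta_{b(\beta)}(c)-\beta_{b(\beta)})$ and $\sqrt n(\hat\beta^{o}_{b(\beta)}-\beta_{b(\beta)})$ both converge in distribution to $N(0,\sigma^2\Sigma_{b(\beta)b(\beta)}^{-1})$, where $\hat\beta^{o}_{b(\beta)}=(\mathbf X_{b(\beta)}'\mathbf X_{b(\beta)})^{-1}\mathbf X_{b(\beta)}'(\mathbf Y-\mathbf X_{\bar b(\beta)}c_{\bar b(\beta)})$ is the oracle LSE in the true submodel. -/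

import Mathlib

open MeasureTheory ProbabilityTheory Filter Topology Matrix

namespace OracleHodges

noncomputable section

variable {ι κ : Type*} [Fintype ι] [DecidableEq ι] [Fintype κ]

/-- The least squares estimate `(X'X)⁻¹ X'y` (meaningful when `X'X` is invertible). -/
def leastSquares (X : Matrix κ ι ℝ) (y : κ → ℝ) : EuclideanSpace ℝ ι :=
  WithLp.toLp 2 (((Xᵀ * X)⁻¹ * Xᵀ) *ᵥ y)

/-- The columns of `X` with index in `b`. -/
def colsIn (X : Matrix κ ι ℝ) (b : Finset ι) : Matrix κ {j // j ∈ b} ℝ :=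
  X.submatrix id Subtype.val

/-- The columns of `X` with index outside `b`. -/
def colsOut (X : Matrix κ ι ℝ) (b : Finset ι) : Matrix κ {j // j ∉ b} ℝ :=
  X.submatrix id Subtype.val

/-- The subvector `x_b`. -/
def subvec (b : Finset ι) (x : EuclideanSpace ℝ ι) : EuclideanSpace ℝ {j // j ∈ b} :=
  WithLp.toLp 2 fun j => x j

/-- The principal submatrix `M_bb`. -/
def blockIn (M : Matrix ι ι ℝ) (b : Finset ι) : Matrix {j // j ∈ b} {j // j ∈ b} ℝ :=
  M.toBlock (· ∈ b) (· ∈ b)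

/-- The off-diagonal block of `M` with rows in `b` and columns in the complement of `b`. -/
def blockOff (M : Matrix ι ι ℝ) (b : Finset ι) : Matrix {j // j ∈ b} {j // j ∉ b} ℝ :=
  M.toBlock (· ∈ b) (· ∉ b)

/-- The block matrix `diag(A, 0)`, with `A` in the rows and columns of `b`, written in the original
order of the coordinates. -/
def padZero (b : Finset ι) (A : Matrix {j // j ∈ b} {j // j ∈ b} ℝ) : Matrix ι ι ℝ :=
  Matrix.reindex (Equiv.sumCompl (· ∈ b)) (Equiv.sumCompl (· ∈ b))
    (Matrix.fromBlocks A 0 0 (0 : Matrix {j // j ∉ b} {j // j ∉ b} ℝ))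

/-- `b(θ) = {j : θ_j ≠ c_j}`. -/
def activeSet (θ c : EuclideanSpace ℝ ι) : Finset ι := Finset.univ.filter fun j => θ j ≠ c j

/-- The selected set `{j : |t_j - c_j| > a_j}`, where `t` is the base estimate. -/
def selectedSet (t c : EuclideanSpace ℝ ι) (a : ι → ℝ) : Finset ι :=
  Finset.univ.filter fun j => a j < |t j - c j|

/-- The vector whose `b`-part is `t_b + V_bb⁻¹ V_bb̄ (t_b̄ - c_b̄)` and whose remaining part is
`c_b̄`. It is `t` when `b` is the full index set and `c` when `b` is empty. -/
def adjusted (V : Matrix ι ι ℝ) (t c : EuclideanSpace ℝ ι) (b : Finset ι) : EuclideanSpace ℝ ι :=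
  WithLp.toLp 2 fun j =>
    if h : j ∈ b then
      t j + (((blockIn V b)⁻¹ * blockOff V b) *ᵥ fun i : {i // i ∉ b} => t i - c i) ⟨j, h⟩
    else c j

/-- The oracle Hodges' estimate with base estimate `t`, center `c`, thresholds `a`, and estimate
`V` of the inverse of the asymptotic covariance matrix of the base estimator. -/
def oracleHodges (V : Matrix ι ι ℝ) (t c : EuclideanSpace ℝ ι) (a : ι → ℝ) :
    EuclideanSpace ℝ ι :=
  adjusted V t c (selectedSet t c a)

/-- The oracle least squares estimate of the `b`-part, computed in the submodel in which the
coordinates outside `b` are known to be those of `c`: `(X_b'X_b)⁻¹ X_b'(y - X_b̄ c_b̄)`. -/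
def oracleLeastSquares (X : Matrix κ ι ℝ) (y : κ → ℝ) (c : EuclideanSpace ℝ ι) (b : Finset ι) :
    EuclideanSpace ℝ {j // j ∈ b} :=
  leastSquares (colsIn X b) (y - colsOut X b *ᵥ fun j : {j // j ∉ b} => c j)

/-- Convergence in distribution of the random vectors `T n` to `N(0, S)`. -/
def TendstoNormal {Ω : Type*} [MeasurableSpace Ω] (P : Measure Ω) [IsProbabilityMeasure P]
    (T : ℕ → Ω → EuclideanSpace ℝ ι) (S : Matrix ι ι ℝ) : Prop :=
  TendstoInDistribution T atTop (id : EuclideanSpace ℝ ι → EuclideanSpace ℝ ι) (fun _ => P)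
    (multivariateGaussian 0 S)

/-- The Lindeberg condition for the array of summands `n^{-1/2} ε_{ni} x_{ni}` of
`n^{-1/2} X_n' ε_n`, where `x_{ni}` is the `i`-th row of `X_n`. -/
def LindebergCondition {Ω : Type*} [MeasurableSpace Ω] (P : Measure Ω)
    (X : (n : ℕ) → Matrix (Fin n) ι ℝ) (ε : (n : ℕ) → Fin n → Ω → ℝ) : Prop :=
  ∀ δ : ℝ, 0 < δ → Tendsto (fun n : ℕ => (n : ℝ)⁻¹ * ∑ i : Fin n,
    ‖(WithLp.toLp 2 (X n i) : EuclideanSpace ℝ ι)‖ ^ 2 *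
      ∫ ω, Set.indicator
        {ω | δ * √(n : ℝ) < ‖(WithLp.toLp 2 (X n i) : EuclideanSpace ℝ ι)‖ * |ε n i ω|}
        (fun ω => ε n i ω ^ 2) ω ∂P) atTop (𝓝 0)

end

end OracleHodges

/-!
The argument reduces everything to linear images of one asymptotically normal vector.

*Asymptotic normality of the least squares estimator.* Once `X'X` is invertible,
`√n (β̂ - β) = (n⁻¹X'X)⁻¹ · n^{-1/2}X'ε`, so the estimator and the normalized score `n^{-1/2}X'ε` are
asymptotically normal together (`tendstoNormal_leastSquares_iff_score`). The score is treated through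
its characteristic function: in a direction `t` it is a weighted sum of the independent errors, the
characteristic function factors, and each factor is compared with that of a normal variable by a
second-order Taylor expansion whose error is the truncated second moment in the Lindeberg condition
(`norm_charFun_weighted_sum_sub_le`). Lévy's continuity theorem then gives `tendstoNormal_score`.

*The oracle Hodges' estimator.* Since `√n (β̂ - β)` is bounded in probability, while the thresholds
tend to zero more slowly than `n^{-1/2}`, the selected set equals `b = b(β)` with probability tending
to one (`tendsto_measure_selectedSet_ne`). On that event the estimator has the correct value outside
`b`, and `√n (β̃ - β) = G(V̂) √n (β̂ - β)`, where `G(V)` (`adjustMatrix`) depends continuously on `V`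
near the positive definite limit `V = Γ⁻¹`, `Γ = σ²S⁻¹`. Slutsky's theorem (`TendstoNormal.mulVec`)
gives the limit `N(0, GΓG')`. The correction term in the definition of the estimator is chosen so
that `G(V) = diag(V_bb⁻¹, 0) V`, whence `GΓG' = diag(V_bb⁻¹, 0)` (`adjustMatrix_mul_mul_transpose`),
and `V_bb⁻¹ = σ² S_bb⁻¹`.

*The oracle least squares estimator.* It is the least squares estimator of a submodel with the same
errors, and the score of the submodel is a subvector of the full score (`score_colsIn`). The
equivalence between estimator and score, used in the full model and then in the submodel, transfers
asymptotic normality without any independence or Lindeberg assumption.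
-/

namespace OracleHodges

/-! ### Convergence in probability and in distribution -/

section Convergence

variable {Ω : Type*} [MeasurableSpace Ω] {P : Measure Ω}
  {ι κ : Type*} [Fintype ι] [Fintype κ]

/-- Continuous mapping at a constant limit: for random matrices converging in probability
entrywise, continuity of `f` at the limit suffices. -/
lemma tendstoInMeasure_comp_of_continuousAt {F : Type*} [PseudoMetricSpace F]
    {M : ℕ → Ω → Matrix κ ι ℝ} {M₀ : Matrix κ ι ℝ}
    (hM : ∀ i j, TendstoInMeasure P (fun n ω => M n ω i j) atTop (fun _ => M₀ i j))
    {f : Matrix κ ι ℝ → F} (hf : ContinuousAt f M₀) :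
    TendstoInMeasure P (fun n ω => f (M n ω)) atTop (fun _ => f M₀) := by
  rw [tendstoInMeasure_iff_dist]
  intro ε hε
  have hf' : ∀ᶠ A in 𝓝 M₀, dist (f A) (f M₀) < ε := hf.eventually (Metric.ball_mem_nhds _ hε)
  obtain ⟨δ, hδ, hball⟩ :=
    Metric.eventually_nhds_iff.1 (show ∀ᶠ A : κ → ι → ℝ in 𝓝 M₀, dist (f A) (f M₀) < ε from hf')
  have hsum : Tendsto (fun n => ∑ i, ∑ j, P {ω | δ ≤ dist (M n ω i j) (M₀ i j)}) atTop (𝓝 0) := by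
    have := tendsto_finsetSum (Finset.univ : Finset κ) fun i _ =>
      tendsto_finsetSum (Finset.univ : Finset ι) fun j _ =>
        tendstoInMeasure_iff_dist.1 (hM i j) δ hδ
    simpa using this
  refine tendsto_of_tendsto_of_tendsto_of_le_of_le tendsto_const_nhds hsum (fun _ => zero_le)
    fun n => ?_
  have hsub : {ω | ε ≤ dist (f (M n ω)) (f M₀)} ⊆
      ⋃ i, ⋃ j, {ω | δ ≤ dist (M n ω i j) (M₀ i j)} := by
    intro ω hω
    by_contra hcon
    simp only [Set.mem_iUnion, Set.mem_ofPred_eq, not_exists, not_le] at hcon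
    refine absurd (hball (y := M n ω) ?_) (not_lt.2 hω)
    exact (dist_pi_lt_iff hδ).2 fun i => (dist_pi_lt_iff hδ).2 fun j => hcon i j
  calc P {ω | ε ≤ dist (f (M n ω)) (f M₀)} ≤ _ := measure_mono hsub
    _ ≤ ∑ i, P (⋃ j, {ω | δ ≤ dist (M n ω i j) (M₀ i j)}) := measure_iUnion_fintype_le _ _
    _ ≤ _ := Finset.sum_le_sum fun i _ => measure_iUnion_fintype_le _ _

variable [IsProbabilityMeasure P]

/-- Sets whose complements have vanishing probability have probability tending to one. The
subadditive form of the argument needs no measurability. -/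
lemma tendsto_measure_one_of_compl {A : ℕ → Set Ω}
    (h : Tendsto (fun n => P (A n)ᶜ) atTop (𝓝 0)) : Tendsto (fun n => P (A n)) atTop (𝓝 1) := by
  have h1 : Tendsto (fun n => 1 - P (A n)ᶜ) atTop (𝓝 1) := by
    simpa using ENNReal.Tendsto.sub tendsto_const_nhds h (Or.inl ENNReal.one_ne_top)
  refine tendsto_of_tendsto_of_tendsto_of_le_of_le h1 tendsto_const_nhds (fun n => ?_)
    fun n => prob_le_one
  rw [tsub_le_iff_right]
  calc (1 : ENNReal) = P (A n ∪ (A n)ᶜ) := by simp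
    _ ≤ _ := measure_union_le _ _

/-- A sequence converging in distribution is bounded in probability. -/
lemma tendsto_measure_le_norm_of_tendstoInDistribution {E Ω' : Type*} [NormedAddCommGroup E]
    [MeasurableSpace E] [BorelSpace E] [MeasurableSpace Ω'] {P' : Measure Ω'}
    [IsProbabilityMeasure P'] {T : ℕ → Ω → E} {Z : Ω' → E}
    (h : TendstoInDistribution T atTop Z (fun _ => P) P') {r : ℕ → ℝ} (hr : Tendsto r atTop atTop) :
    Tendsto (fun n => P {ω | r n ≤ ‖T n ω‖}) atTop (𝓝 0) := by
  have hZ := h.aemeasurable_limit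
  have : IsProbabilityMeasure (P'.map Z) := Measure.isProbabilityMeasure_map hZ
  have hcl : ∀ m : ℕ, IsClosed {x : E | (m : ℝ) ≤ ‖x‖} := fun m =>
    isClosed_le continuous_const continuous_norm
  -- the tail of the limit law vanishes
  have htail : Tendsto (fun m : ℕ => P'.map Z {x : E | (m : ℝ) ≤ ‖x‖}) atTop (𝓝 0) := by
    have hempty : ⋂ m : ℕ, {x : E | (m : ℝ) ≤ ‖x‖} = ∅ := by
      ext x
      obtain ⟨m, hm⟩ := exists_nat_gt ‖x‖
      simpa using ⟨m, hm⟩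
    rw [← measure_empty (μ := P'.map Z), ← hempty]
    refine tendsto_measure_iInter_atTop (fun m => (hcl m).measurableSet.nullMeasurableSet) ?_
      ⟨0, measure_ne_top _ _⟩
    intro m k hmk x hx
    exact le_trans (show (m : ℝ) ≤ k by exact_mod_cast hmk) (show (k : ℝ) ≤ ‖x‖ from hx)
  rw [ENNReal.tendsto_nhds_zero]
  intro ε hε
  obtain ⟨m, hm⟩ := (htail.eventually (gt_mem_nhds hε)).exists
  have hport := ProbabilityMeasure.limsup_measure_closed_le_of_tendsto h.tendsto (hcl m)
  have hlt := eventually_lt_of_limsup_lt (hport.trans_lt hm)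
  filter_upwards [hlt, hr.eventually_ge_atTop (m : ℝ)] with n hn hrn
  rw [ProbabilityMeasure.coe_mk,
    Measure.map_apply_of_aemeasurable (h.forall_aemeasurable n) (hcl m).measurableSet] at hn
  exact (measure_mono fun ω hω => le_trans hrn hω).trans hn.le

variable [DecidableEq ι] [DecidableEq κ]

/-- Modifying the variables on events of vanishing probability does not affect the limit in
distribution. -/
lemma TendstoNormal.congr_of_tendsto_measure_ne {T T' : ℕ → Ω → EuclideanSpace ℝ ι}
    {S : Matrix ι ι ℝ} (h : TendstoNormal P T S) (hT' : ∀ n, AEMeasurable (T' n) P)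
    (hne : Tendsto (fun n => P {ω | T' n ω ≠ T n ω}) atTop (𝓝 0)) : TendstoNormal P T' S := by
  refine tendstoInDistribution_of_tendstoInMeasure_sub T' _ h ?_ hT'
  rw [tendstoInMeasure_iff_norm]
  intro ε hε
  refine tendsto_of_tendsto_of_tendsto_of_le_of_le tendsto_const_nhds hne (fun _ => zero_le)
    fun n => measure_mono fun ω hω heq => ?_
  simp only [Set.mem_ofPred_eq, Pi.sub_apply, Pi.zero_apply, heq, sub_self, norm_zero] at hω
  exact absurd hω (not_le.2 hε)

lemma TendstoNormal.congr_of_eventually_eq {T T' : ℕ → Ω → EuclideanSpace ℝ ι}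
    {S : Matrix ι ι ℝ} (h : TendstoNormal P T S) (hT' : ∀ n, AEMeasurable (T' n) P)
    (heq : ∀ᶠ n in atTop, T' n = T n) : TendstoNormal P T' S := by
  refine h.congr_of_tendsto_measure_ne hT' (tendsto_const_nhds.congr' ?_)
  filter_upwards [heq] with n hn
  simp [hn]

/-- The image of `N(0, S)` under the matrix `M` is `N(0, M S Mᵀ)`. -/
lemma map_mulVec_multivariateGaussian {S : Matrix ι ι ℝ} (hS : S.PosSemidef) (M : Matrix κ ι ℝ) :
    (multivariateGaussian 0 S).map
      (fun z : EuclideanSpace ℝ ι => (WithLp.toLp 2 (M *ᵥ z) : EuclideanSpace ℝ κ)) =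
      multivariateGaussian 0 (M * S * Mᵀ) := by
  have hmeas : Measurable
      (fun z : EuclideanSpace ℝ ι => (WithLp.toLp 2 (M *ᵥ z) : EuclideanSpace ℝ κ)) := by
    fun_prop
  have hPSD : (M * S * Mᵀ).PosSemidef := by
    simpa using hS.mul_mul_conjTranspose_same M
  have : IsProbabilityMeasure ((multivariateGaussian 0 S).map
      (fun z : EuclideanSpace ℝ ι => (WithLp.toLp 2 (M *ᵥ z) : EuclideanSpace ℝ κ))) :=
    Measure.isProbabilityMeasure_map hmeas.aemeasurable
  apply Measure.ext_of_charFun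
  ext t
  have hin : ∀ z : EuclideanSpace ℝ ι,
      inner ℝ (WithLp.toLp 2 (M *ᵥ z) : EuclideanSpace ℝ κ) t =
        inner ℝ z (WithLp.toLp 2 (Mᵀ *ᵥ t) : EuclideanSpace ℝ ι) := by
    intro z
    simp only [EuclideanSpace.inner_eq_star_dotProduct, star_trivial]
    rw [Matrix.mulVec_transpose, Matrix.dotProduct_mulVec]
  rw [charFun_apply, integral_map hmeas.aemeasurable (by fun_prop)]
  simp_rw [hin]
  rw [← charFun_apply, charFun_multivariateGaussian hS, charFun_multivariateGaussian hPSD]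
  congr 3
  · simp
  · simp only [Matrix.mulVec_transpose, ← Matrix.mulVec_mulVec, Matrix.dotProduct_mulVec,
      Matrix.vecMul_vecMul, Matrix.mul_assoc]

/-- Slutsky's theorem for random linear maps applied to asymptotically normal vectors. -/
lemma TendstoNormal.mulVec {T : ℕ → Ω → EuclideanSpace ℝ ι} {S : Matrix ι ι ℝ}
    (hS : S.PosSemidef) (h : TendstoNormal P T S)
    {M : ℕ → Ω → Matrix κ ι ℝ} {M₀ : Matrix κ ι ℝ}
    (hmeas : ∀ n i j, AEMeasurable (fun ω => M n ω i j) P)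
    (hM : ∀ i j, TendstoInMeasure P (fun n ω => M n ω i j) atTop (fun _ => M₀ i j)) :
    TendstoNormal P (fun n ω => WithLp.toLp 2 (M n ω *ᵥ T n ω)) (M₀ * S * M₀ᵀ) := by
  have hY : TendstoInMeasure P (fun n ω => (fun i j => M n ω i j : κ → ι → ℝ)) atTop
      (fun _ => (fun i j => M₀ i j : κ → ι → ℝ)) :=
    tendstoInMeasure_comp_of_continuousAt hM (f := fun A => (fun i j => A i j : κ → ι → ℝ))
      continuous_id.continuousAt
  have hYm : ∀ n, AEMeasurable (fun ω => (fun i j => M n ω i j : κ → ι → ℝ)) P := fun n =>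
    aemeasurable_pi_lambda _ fun i => aemeasurable_pi_lambda _ fun j => hmeas n i j
  have hg : Continuous fun p : EuclideanSpace ℝ ι × (κ → ι → ℝ) =>
      (WithLp.toLp 2 (Matrix.of p.2 *ᵥ p.1) : EuclideanSpace ℝ κ) := by
    refine (PiLp.continuous_toLp 2 _).comp ?_
    refine Continuous.matrix_mulVec ?_ ?_
    · exact continuous_snd
    · exact (PiLp.continuous_ofLp 2 _).comp continuous_fst
  have key := h.continuous_comp_prodMk_of_tendstoInMeasure_const hg hY hYm
  refine ⟨key.forall_aemeasurable, aemeasurable_id, ?_⟩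
  have hlaw : (multivariateGaussian 0 (M₀ * S * M₀ᵀ)).map id = (multivariateGaussian 0 S).map
      (fun z : EuclideanSpace ℝ ι => (WithLp.toLp 2 (M₀ *ᵥ z) : EuclideanSpace ℝ κ)) := by
    rw [Measure.map_id, map_mulVec_multivariateGaussian hS]
  simp_rw [hlaw]
  exact key.tendsto

end Convergence

/-! ### The Lindeberg central limit theorem for weighted sums -/

section Lindeberg

/-- Second-order Taylor bound for `exp (ix)`: the cubic estimate is used for `|x| ≤ δ` and a crude
quadratic one otherwise. -/
lemma norm_exp_mul_I_sub_taylor_le {δ : ℝ} (hδ0 : 0 < δ) (hδ1 : δ ≤ 1) (x : ℝ) :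
    ‖Complex.exp (x * Complex.I) - (1 + x * Complex.I - (x : ℂ) ^ 2 / 2)‖ ≤
      δ * x ^ 2 + 4 * if δ < |x| then x ^ 2 else 0 := by
  have hnorm : ‖(x : ℂ) * Complex.I‖ = |x| := by simp
  have hsmall : |x| ≤ 1 →
      ‖Complex.exp (x * Complex.I) - (1 + x * Complex.I - (x : ℂ) ^ 2 / 2)‖ ≤ |x| ^ 3 := by
    intro hx
    have h := Complex.exp_bound (x := x * Complex.I) (by rw [hnorm]; exact hx) (n := 3) (by norm_num)
    have hs : ∑ m ∈ Finset.range 3, ((x : ℂ) * Complex.I) ^ m / m.factorial =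
        1 + x * Complex.I - (x : ℂ) ^ 2 / 2 := by
      simp [Finset.sum_range_succ, Nat.factorial, mul_pow]
      ring
    rw [hs, hnorm] at h
    refine h.trans ?_
    have : (0 : ℝ) ≤ |x| ^ 3 := by positivity
    norm_num [Nat.factorial]
    linarith
  have hcube : |x| ^ 3 = |x| * x ^ 2 := by rw [← sq_abs x]; ring
  have hx2 : 0 ≤ x ^ 2 := sq_nonneg x
  split_ifs with h
  · rcases le_or_gt |x| 1 with hx | hx
    · refine (hsmall hx).trans ?_
      rw [hcube]
      nlinarith [mul_nonneg hδ0.le hx2]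
    · have h1 : ‖Complex.exp (x * Complex.I) - (1 + x * Complex.I - (x : ℂ) ^ 2 / 2)‖ ≤
          1 + (1 + |x| + x ^ 2 / 2) := by
        refine (norm_sub_le _ _).trans (add_le_add (Complex.norm_exp_ofReal_mul_I x).le ?_)
        refine (norm_sub_le _ _).trans (add_le_add ((norm_add_le _ _).trans ?_) ?_)
        · rw [hnorm, norm_one]
        · simp
      have hsq : |x| ≤ x ^ 2 := by rw [← sq_abs x]; nlinarith
      have hsq1 : 1 ≤ x ^ 2 := by linarith
      nlinarith [mul_nonneg hδ0.le hx2]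
  · have hx : |x| ≤ δ := not_lt.1 h
    refine (hsmall (hx.trans hδ1)).trans ?_
    rw [hcube]
    nlinarith

/-- A product of complex numbers of norm at most one depends on its factors in a `1`-Lipschitz
way for the sum of the distances. -/
lemma norm_prod_sub_prod_le_sum {α : Type*} (s : Finset α) {f g : α → ℂ}
    (hf : ∀ i, ‖f i‖ ≤ 1) (hg : ∀ i, ‖g i‖ ≤ 1) :
    ‖∏ i ∈ s, f i - ∏ i ∈ s, g i‖ ≤ ∑ i ∈ s, ‖f i - g i‖ := by
  classical
  induction s using Finset.induction_on with
  | empty => simp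
  | insert a s ha ih =>
    rw [Finset.prod_insert ha, Finset.prod_insert ha, Finset.sum_insert ha]
    have hsplit : f a * ∏ i ∈ s, f i - g a * ∏ i ∈ s, g i =
        (f a - g a) * ∏ i ∈ s, f i + g a * (∏ i ∈ s, f i - ∏ i ∈ s, g i) := by ring
    have hprod : ‖∏ i ∈ s, f i‖ ≤ 1 := by
      rw [norm_prod]
      exact Finset.prod_le_one (fun i _ => norm_nonneg _) fun i _ => hf i
    rw [hsplit]
    refine (norm_add_le _ _).trans (add_le_add ?_ ?_)
    · rw [norm_mul]
      exact mul_le_of_le_one_right (norm_nonneg _) hprod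
    · rw [norm_mul]
      exact (mul_le_of_le_one_left (norm_nonneg _) (hg a)).trans ih

lemma abs_one_sub_sub_exp_neg_le {s : ℝ} (hs : 0 ≤ s) : |1 - s - Real.exp (-s)| ≤ s ^ 2 := by
  rcases le_or_gt s 1 with h1 | h1
  · have h := Real.abs_exp_sub_one_sub_id_le (x := -s) (by rw [abs_neg, abs_of_nonneg hs]; exact h1)
    rw [abs_sub_comm]
    simpa [sub_eq_add_neg, add_comm, add_left_comm, add_assoc] using h
  · have h2 : Real.exp (-s) ≤ 1 := Real.exp_le_one_iff.2 (by linarith)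
    have h3 := Real.add_one_le_exp (-s)
    rw [abs_le]
    constructor <;> nlinarith

variable {Ω : Type*} [MeasurableSpace Ω] {P : Measure Ω}

/-- The truncated second moment `E[(wξ)² 1(δ < |wξ|)]` that governs the Lindeberg condition. -/
noncomputable def truncMoment (P : Measure Ω) (ξ : Ω → ℝ) (w δ : ℝ) : ℝ :=
  ∫ ω, Set.indicator {ω | δ < |w * ξ ω|} (fun ω => (w * ξ ω) ^ 2) ω ∂P

lemma truncMoment_nonneg (ξ : Ω → ℝ) (w δ : ℝ) : 0 ≤ truncMoment P ξ w δ :=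
  integral_nonneg fun _ => Set.indicator_nonneg (fun _ _ => sq_nonneg _) _

lemma integrable_indicator_sq {ξ : Ω → ℝ} (hξ : MemLp ξ 2 P) (r w δ : ℝ) :
    Integrable (fun ω => Set.indicator {ω | δ < r * |w * ξ ω|} (fun ω => (w * ξ ω) ^ 2) ω) P := by
  have hm : AEMeasurable ξ P := hξ.aemeasurable
  exact (hξ.const_mul w).integrable_sq.indicator₀ (nullMeasurableSet_lt (by fun_prop) (by fun_prop))

variable [IsProbabilityMeasure P]

/-- Second-order expansion of the characteristic function of a centered variable, with an error
controlled by the truncated second moment. -/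
lemma norm_charFun_sub_taylor_le {ξ : Ω → ℝ} {σ δ : ℝ} (hδ0 : 0 < δ) (hδ1 : δ ≤ 1)
    (hξ : MemLp ξ 2 P) (hmean : ∫ ω, ξ ω ∂P = 0) (hvar : ∫ ω, ξ ω ^ 2 ∂P = σ ^ 2) (w : ℝ) :
    ‖charFun (P.map ξ) w - (1 - ((w ^ 2 * σ ^ 2 / 2 : ℝ) : ℂ))‖ ≤
      δ * (w ^ 2 * σ ^ 2) + 4 * truncMoment P ξ w δ := by
  have hm : AEMeasurable ξ P := hξ.aemeasurable
  have hxint : Integrable ξ P := hξ.integrable (by norm_num)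
  have hsq : Integrable (fun ω => ξ ω ^ 2) P := hξ.integrable_sq
  have hind := integrable_indicator_sq hξ 1 w δ
  simp only [one_mul] at hind
  have hexp : Integrable (fun ω => Complex.exp ((w * ξ ω : ℝ) * Complex.I)) P := by
    refine Integrable.of_bound (by fun_prop) 1 (ae_of_all _ fun ω => ?_)
    exact (Complex.norm_exp_ofReal_mul_I _).le
  have hlin : Integrable (fun ω => ((w * ξ ω : ℝ) : ℂ) * Complex.I) P :=
    (hxint.const_mul w).ofReal.mul_const _
  have hquad : ∀ ω, ((w * ξ ω : ℝ) : ℂ) ^ 2 / 2 = ((w ^ 2 * ξ ω ^ 2 / 2 : ℝ) : ℂ) := by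
    intro ω; push_cast; ring
  have hquadint : Integrable (fun ω => ((w * ξ ω : ℝ) : ℂ) ^ 2 / 2) P := by
    simp_rw [hquad]
    exact ((hsq.const_mul (w ^ 2)).div_const 2).ofReal
  have haff : Integrable (fun ω => 1 + ((w * ξ ω : ℝ) : ℂ) * Complex.I) P :=
    (integrable_const 1).add hlin
  have hpoly : Integrable (fun ω => 1 + ((w * ξ ω : ℝ) : ℂ) * Complex.I -
      ((w * ξ ω : ℝ) : ℂ) ^ 2 / 2) P := haff.sub hquadint
  have hpolyval : ∫ ω, (1 + ((w * ξ ω : ℝ) : ℂ) * Complex.I - ((w * ξ ω : ℝ) : ℂ) ^ 2 / 2) ∂P =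
      1 - ((w ^ 2 * σ ^ 2 / 2 : ℝ) : ℂ) := by
    have e1 : ∫ ω, ((w * ξ ω : ℝ) : ℂ) * Complex.I ∂P = 0 := by
      rw [integral_mul_const, integral_complex_ofReal, integral_const_mul, hmean]
      simp
    have e2 : ∫ ω, ((w * ξ ω : ℝ) : ℂ) ^ 2 / 2 ∂P = ((w ^ 2 * σ ^ 2 / 2 : ℝ) : ℂ) := by
      simp_rw [hquad]
      rw [integral_complex_ofReal, integral_div, integral_const_mul, hvar]
    rw [integral_sub haff hquadint, integral_add (integrable_const _) hlin, e1, e2]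
    simp
  have hcf : charFun (P.map ξ) w = ∫ ω, Complex.exp ((w * ξ ω : ℝ) * Complex.I) ∂P := by
    rw [charFun_apply_real, integral_map hm (by fun_prop)]
    simp
  rw [hcf, ← hpolyval, ← integral_sub hexp hpoly]
  refine (norm_integral_le_integral_norm _).trans ?_
  have hrhs : δ * (w ^ 2 * σ ^ 2) + 4 * truncMoment P ξ w δ =
      ∫ ω, (δ * (w * ξ ω) ^ 2 +
        4 * Set.indicator {ω | δ < |w * ξ ω|} (fun ω => (w * ξ ω) ^ 2) ω) ∂P := by
    rw [integral_add ((hξ.const_mul w).integrable_sq.const_mul δ) (hind.const_mul 4),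
      integral_const_mul, integral_const_mul, truncMoment]
    simp_rw [mul_pow]
    rw [integral_const_mul, hvar]
  rw [hrhs]
  refine integral_mono (hexp.sub hpoly).norm
    (((hξ.const_mul w).integrable_sq.const_mul δ).add (hind.const_mul 4)) fun ω => ?_
  have h := norm_exp_mul_I_sub_taylor_le hδ0 hδ1 (w * ξ ω)
  simpa [Set.indicator_apply] using h

lemma sq_mul_le_sq_add_truncMoment {ξ : Ω → ℝ} {σ : ℝ} (δ : ℝ)
    (hξ : MemLp ξ 2 P) (hvar : ∫ ω, ξ ω ^ 2 ∂P = σ ^ 2) (w : ℝ) :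
    w ^ 2 * σ ^ 2 ≤ δ ^ 2 + truncMoment P ξ w δ := by
  have hind := integrable_indicator_sq hξ 1 w δ
  simp only [one_mul] at hind
  have h1 : w ^ 2 * σ ^ 2 = ∫ ω, (w * ξ ω) ^ 2 ∂P := by
    simp_rw [mul_pow]
    rw [integral_const_mul, hvar]
  have h2 : δ ^ 2 + truncMoment P ξ w δ = ∫ ω, (δ ^ 2 +
      Set.indicator {ω | δ < |w * ξ ω|} (fun ω => (w * ξ ω) ^ 2) ω) ∂P := by
    rw [integral_add (integrable_const _) hind, truncMoment]
    simp
  rw [h1, h2]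
  refine integral_mono (hξ.const_mul w).integrable_sq ((integrable_const _).add hind) fun ω => ?_
  simp only [Set.indicator_apply, Set.mem_ofPred_eq]
  split_ifs with h
  · nlinarith
  · have h' := not_lt.1 h
    simp only [add_zero]
    exact sq_le_sq' (by linarith [neg_abs_le (w * ξ ω)]) ((le_abs_self _).trans h')

/-- Nonasymptotic Lindeberg bound: the characteristic function of a weighted sum of independent
centered variables is close to that of a normal variable of the same variance. -/
lemma norm_charFun_weighted_sum_sub_le {α : Type*} [Fintype α] {ξ : α → Ω → ℝ} {σ δ : ℝ}
    (hδ0 : 0 < δ) (hδ1 : δ ≤ 1) (hξ : ∀ i, MemLp (ξ i) 2 P) (hmean : ∀ i, ∫ ω, ξ i ω ∂P = 0)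
    (hvar : ∀ i, ∫ ω, ξ i ω ^ 2 ∂P = σ ^ 2) (hind : iIndepFun ξ P) (w : α → ℝ) :
    ‖∫ ω, Complex.exp (((∑ i, w i * ξ i ω : ℝ) : ℂ) * Complex.I) ∂P -
        Complex.exp ((-(σ ^ 2 * ∑ i, w i ^ 2) / 2 : ℝ) : ℂ)‖ ≤
      2 * δ * (σ ^ 2 * ∑ i, w i ^ 2) + 4 * ∑ i, truncMoment P (ξ i) (w i) δ +
        (∑ i, truncMoment P (ξ i) (w i) δ) * (σ ^ 2 * ∑ i, w i ^ 2) := by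
  have hm : ∀ i, AEMeasurable (ξ i) P := fun i => (hξ i).aemeasurable
  have hprod : ∫ ω, Complex.exp (((∑ i, w i * ξ i ω : ℝ) : ℂ) * Complex.I) ∂P =
      ∏ i, charFun (P.map (ξ i)) (w i) := by
    have hind' : iIndepFun (fun i ω => w i * ξ i ω) P :=
      hind.comp (fun i x => w i * x) fun i => by fun_prop
    have h := congrFun (hind'.charFun_map_fun_sum_eq_prod fun i => (hm i).const_mul (w i)) 1
    rw [charFun_apply_real, integral_map (by fun_prop) (by fun_prop), Finset.prod_apply] at h
    simp_rw [charFun_map_mul_comp (hm _), mul_one] at h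
    simpa using h
  have hexp : Complex.exp ((-(σ ^ 2 * ∑ i, w i ^ 2) / 2 : ℝ) : ℂ) =
      ∏ i, ((Real.exp (-(w i ^ 2 * σ ^ 2 / 2)) : ℝ) : ℂ) := by
    rw [← Complex.ofReal_prod, ← Real.exp_sum, ← Complex.ofReal_exp]
    congr 2
    rw [Finset.sum_neg_distrib, ← Finset.sum_div, ← Finset.sum_mul]
    ring
  rw [hprod, hexp]
  have hprob : ∀ i, IsProbabilityMeasure (P.map (ξ i)) := fun i =>
    Measure.isProbabilityMeasure_map (hm i)
  refine (norm_prod_sub_prod_le_sum _ (fun i => norm_charFun_le_one _) fun i => ?_).trans ?_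
  · rw [Complex.norm_real, Real.norm_eq_abs, abs_of_pos (Real.exp_pos _)]
    exact Real.exp_le_one_iff.2 (by have := mul_nonneg (sq_nonneg (w i)) (sq_nonneg σ); linarith)
  set L := ∑ i, truncMoment P (ξ i) (w i) δ with hL
  have hterm : ∀ i, ‖charFun (P.map (ξ i)) (w i) -
      ((Real.exp (-(w i ^ 2 * σ ^ 2 / 2)) : ℝ) : ℂ)‖ ≤
      2 * δ * (σ ^ 2 * w i ^ 2) + 4 * truncMoment P (ξ i) (w i) δ + L * (σ ^ 2 * w i ^ 2) := by
    intro i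
    have hs : 0 ≤ w i ^ 2 * σ ^ 2 := mul_nonneg (sq_nonneg _) (sq_nonneg _)
    have h1 := norm_charFun_sub_taylor_le hδ0 hδ1 (hξ i) (hmean i) (hvar i) (w i)
    have h2 : ‖(1 - ((w i ^ 2 * σ ^ 2 / 2 : ℝ) : ℂ)) -
        ((Real.exp (-(w i ^ 2 * σ ^ 2 / 2)) : ℝ) : ℂ)‖ ≤ (w i ^ 2 * σ ^ 2 / 2) ^ 2 := by
      have := abs_one_sub_sub_exp_neg_le (s := w i ^ 2 * σ ^ 2 / 2) (by linarith)
      rw [← Real.norm_eq_abs, ← Complex.norm_real] at this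
      simpa using this
    -- the variance of each summand is uniformly small
    have h3 : w i ^ 2 * σ ^ 2 ≤ δ + L := by
      have h4 := sq_mul_le_sq_add_truncMoment δ (hξ i) (hvar i) (w i)
      have h5 : truncMoment P (ξ i) (w i) δ ≤ L :=
        Finset.single_le_sum (f := fun i => truncMoment P (ξ i) (w i) δ)
          (fun i _ => truncMoment_nonneg _ _ _) (Finset.mem_univ i)
      nlinarith
    refine (norm_sub_le_norm_sub_add_norm_sub _ (1 - ((w i ^ 2 * σ ^ 2 / 2 : ℝ) : ℂ)) _).trans ?_
    have h6 := mul_le_mul_of_nonneg_right h3 hs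
    nlinarith
  refine (Finset.sum_le_sum fun i _ => hterm i).trans (le_of_eq ?_)
  rw [Finset.sum_add_distrib, Finset.sum_add_distrib, ← Finset.mul_sum, ← Finset.mul_sum,
    ← Finset.mul_sum, ← Finset.mul_sum, ← Finset.mul_sum]

/-- Lindeberg's theorem for triangular arrays of weighted sums, in terms of characteristic
functions. -/
lemma tendsto_charFun_weighted_sum {ε : (n : ℕ) → Fin n → Ω → ℝ} {σ v : ℝ}
    (hL2 : ∀ n i, MemLp (ε n i) 2 P) (hmean : ∀ n i, ∫ ω, ε n i ω ∂P = 0)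
    (hvar : ∀ n i, ∫ ω, ε n i ω ^ 2 ∂P = σ ^ 2) (hind : ∀ n, iIndepFun (ε n) P)
    {w : (n : ℕ) → Fin n → ℝ}
    (hv : Tendsto (fun n => σ ^ 2 * ∑ i, w n i ^ 2) atTop (𝓝 v))
    (hlind : ∀ δ, 0 < δ → Tendsto (fun n => ∑ i, truncMoment P (ε n i) (w n i) δ) atTop (𝓝 0)) :
    Tendsto (fun n => ∫ ω, Complex.exp (((∑ i, w n i * ε n i ω : ℝ) : ℂ) * Complex.I) ∂P) atTop
      (𝓝 (Complex.exp ((-v / 2 : ℝ) : ℂ))) := by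
  have hdiff : Tendsto (fun n =>
      ∫ ω, Complex.exp (((∑ i, w n i * ε n i ω : ℝ) : ℂ) * Complex.I) ∂P -
        Complex.exp ((-(σ ^ 2 * ∑ i, w n i ^ 2) / 2 : ℝ) : ℂ)) atTop (𝓝 0) := by
    rw [Metric.tendsto_nhds]
    intro e he
    have hv0 : 0 ≤ v := ge_of_tendsto' hv fun n => by positivity
    obtain ⟨δ, hδ0, hδ1, hδe⟩ : ∃ δ : ℝ, 0 < δ ∧ δ ≤ 1 ∧ 2 * δ * v < e := by
      refine ⟨min 1 (e / (2 * v + 1) / 2), by positivity, min_le_left _ _, ?_⟩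
      have h1 : min 1 (e / (2 * v + 1) / 2) ≤ e / (2 * v + 1) / 2 := min_le_right _ _
      have h2 : e / (2 * v + 1) * (2 * v + 1) = e := by field_simp
      have h3 : 0 < e / (2 * v + 1) := by positivity
      nlinarith
    have hbound : Tendsto (fun n => 2 * δ * (σ ^ 2 * ∑ i, w n i ^ 2) +
        4 * ∑ i, truncMoment P (ε n i) (w n i) δ +
        (∑ i, truncMoment P (ε n i) (w n i) δ) * (σ ^ 2 * ∑ i, w n i ^ 2)) atTop
        (𝓝 (2 * δ * v + 4 * 0 + 0 * v)) :=
      ((hv.const_mul _).add ((hlind δ hδ0).const_mul _)).add ((hlind δ hδ0).mul hv)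
    filter_upwards [hbound.eventually_lt_const (u := e) (by simpa using hδe)] with n hn
    rw [dist_zero_right]
    exact (norm_charFun_weighted_sum_sub_le hδ0 hδ1 (hL2 n) (hmean n) (hvar n) (hind n)
      (w n)).trans_lt hn
  have hlim : Tendsto (fun n => Complex.exp ((-(σ ^ 2 * ∑ i, w n i ^ 2) / 2 : ℝ) : ℂ)) atTop
      (𝓝 (Complex.exp ((-v / 2 : ℝ) : ℂ))) := by
    refine (Complex.continuous_exp.comp Complex.continuous_ofReal).continuousAt.tendsto.comp ?_
    exact hv.neg.div_const 2
  simpa using hdiff.add hlim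

end Lindeberg

/-! ### Coordinate projections and matrix inverses -/

section Algebra

variable {ι κ : Type*} [Fintype ι] [DecidableEq ι] [Fintype κ]

/-- The matrix of the projection `x ↦ (x_j)_{p j}` onto the coordinates satisfying `p`. -/
def coordProj (p : ι → Prop) : Matrix {j // p j} ι ℝ :=
  (1 : Matrix ι ι ℝ).submatrix Subtype.val id

lemma coordProj_mul {α : Type*} (p : ι → Prop) (M : Matrix ι α ℝ) :
    coordProj p * M = M.submatrix Subtype.val id := by
  ext i j
  simp [coordProj, Matrix.mul_apply, Matrix.one_apply]

lemma mul_coordProj_transpose {α : Type*} (p : ι → Prop) (M : Matrix α ι ℝ) :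
    M * (coordProj p)ᵀ = M.submatrix id Subtype.val := by
  ext i j
  simp [coordProj, Matrix.mul_apply, Matrix.one_apply]

lemma coordProj_mulVec (p : ι → Prop) (x : ι → ℝ) (j : {j // p j}) :
    (coordProj p *ᵥ x) j = x j := by
  simp [coordProj, Matrix.mulVec, dotProduct, Matrix.one_apply]

omit [Fintype ι] in
lemma coordProj_transpose_mulVec (p : ι → Prop) [DecidablePred p] [Fintype {j // p j}]
    (y : {j // p j} → ℝ) (j : ι) :
    ((coordProj p)ᵀ *ᵥ y) j = if h : p j then y ⟨j, h⟩ else 0 := by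
  simp only [coordProj, Matrix.mulVec, dotProduct, Matrix.transpose_apply, Matrix.submatrix_apply,
    Matrix.one_apply, id_eq, ite_mul, one_mul, zero_mul]
  split_ifs with h
  · rw [Finset.sum_eq_single (⟨j, h⟩ : {j // p j})]
    · simp
    · intro k _ hk
      exact if_neg fun hkj : (k : ι) = j => hk (Subtype.ext hkj)
    · simp
  · exact Finset.sum_eq_zero fun k _ => if_neg fun hkj : (k : ι) = j => h (hkj ▸ k.2)

lemma coordProj_mul_mul_transpose (b : Finset ι) (M : Matrix ι ι ℝ) :
    coordProj (· ∈ b) * M * (coordProj (· ∈ b))ᵀ = blockIn M b := by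
  rw [coordProj_mul, mul_coordProj_transpose]
  rfl

lemma coordProj_mul_mul_transpose_compl (b : Finset ι) (M : Matrix ι ι ℝ) :
    coordProj (· ∈ b) * M * (coordProj (· ∉ b))ᵀ = blockOff M b := by
  rw [coordProj_mul, mul_coordProj_transpose]
  rfl

lemma coordProj_mul_transpose_self (p : ι → Prop) : coordProj p * (coordProj p)ᵀ = 1 := by
  rw [coordProj_mul]
  ext i j
  simp [coordProj, Matrix.one_apply, Subtype.ext_iff]

lemma coordProj_transpose_mul_add_compl (b : Finset ι) :
    (coordProj (· ∈ b))ᵀ * coordProj (· ∈ b) + (coordProj (· ∉ b))ᵀ * coordProj (· ∉ b) =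
      (1 : Matrix ι ι ℝ) := by
  refine Matrix.toLin'.injective (LinearMap.ext fun x => funext fun j => ?_)
  simp only [Matrix.toLin'_apply, Matrix.add_mulVec, ← Matrix.mulVec_mulVec, Pi.add_apply,
    coordProj_transpose_mulVec, Matrix.one_mulVec]
  by_cases h : j ∈ b <;> simp [h, coordProj_mulVec]

omit [Fintype ι] in
lemma padZero_eq (b : Finset ι) (A : Matrix {j // j ∈ b} {j // j ∈ b} ℝ) :
    padZero b A = (coordProj (· ∈ b))ᵀ * A * coordProj (· ∈ b) := by
  ext i j
  obtain ⟨i, rfl⟩ := (Equiv.sumCompl (· ∈ b)).surjective i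
  obtain ⟨j, rfl⟩ := (Equiv.sumCompl (· ∈ b)).surjective j
  have hl : ∀ (k : {j // j ∈ b}) l, coordProj (· ∈ b) k (Equiv.sumCompl (· ∈ b) l) =
      Sum.elim (fun l => (1 : Matrix {j // j ∈ b} {j // j ∈ b} ℝ) k l) (fun _ => 0) l := by
    rintro k (l | l)
    · rw [Equiv.sumCompl_apply_inl, Sum.elim_inl]
      simp only [coordProj, Matrix.submatrix_apply, Matrix.one_apply, id_eq, Subtype.ext_iff]
    · have : (k : ι) ≠ l := fun h => l.2 (h ▸ k.2)
      simp [coordProj, Matrix.one_apply, this]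
  simp only [padZero, Matrix.reindex_apply, Matrix.submatrix_apply, Equiv.symm_apply_apply,
    Matrix.mul_apply, Matrix.transpose_apply, hl]
  rcases i with i | i <;> rcases j with j | j <;> simp [Matrix.one_apply]

omit [Fintype κ] in
lemma colsIn_eq (X : Matrix κ ι ℝ) (b : Finset ι) : colsIn X b = X * (coordProj (· ∈ b))ᵀ :=
  (mul_coordProj_transpose _ _).symm

lemma colsIn_transpose_mul_colsIn (X : Matrix κ ι ℝ) (b : Finset ι) :
    (colsIn X b)ᵀ * colsIn X b = blockIn (Xᵀ * X) b := by
  rw [← coordProj_mul_mul_transpose, colsIn_eq, Matrix.transpose_mul, Matrix.transpose_transpose]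
  simp only [Matrix.mul_assoc]

omit [Fintype κ] in
lemma colsIn_mulVec_add_colsOut_mulVec (X : Matrix κ ι ℝ) (b : Finset ι) (x : ι → ℝ) :
    (colsIn X b *ᵥ fun j : {j // j ∈ b} => x j) + (colsOut X b *ᵥ fun j : {j // j ∉ b} => x j) =
      X *ᵥ x := by
  ext i
  simp only [Pi.add_apply, Matrix.mulVec, dotProduct, colsIn, colsOut, Matrix.submatrix_apply, id]
  convert Fintype.sum_subtype_add_sum_subtype (· ∈ b) fun j => X i j * x j

omit [Fintype ι] [DecidableEq ι] in
lemma posDef_blockIn {M : Matrix ι ι ℝ} (hM : M.PosDef) (b : Finset ι) : (blockIn M b).PosDef :=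
  hM.submatrix Subtype.val_injective

lemma continuousAt_matrix_inv {A : Matrix ι ι ℝ} (hA : IsUnit A.det) :
    ContinuousAt (fun M : Matrix ι ι ℝ => M⁻¹) A := by
  have h : (fun M : Matrix ι ι ℝ => M⁻¹) = fun M => M.det⁻¹ • M.adjugate := by
    funext M
    rw [Matrix.inv_def, Ring.inverse_eq_inv']
  rw [h]
  exact (continuous_id.matrix_det.continuousAt.inv₀ hA.ne_zero).smul
    continuous_id.matrix_adjugate.continuousAt

variable {Ω : Type*} [MeasurableSpace Ω] {P : Measure Ω}

lemma aemeasurable_inv_apply {W : Ω → Matrix ι ι ℝ}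
    (hW : ∀ i j, AEMeasurable (fun ω => W ω i j) P) (i j : ι) :
    AEMeasurable (fun ω => (W ω)⁻¹ i j) P := by
  have hW' : AEMeasurable (fun ω => (fun i j => W ω i j : ι → ι → ℝ)) P :=
    aemeasurable_pi_lambda _ fun i => aemeasurable_pi_lambda _ fun j => hW i j
  have hdet : Measurable fun A : ι → ι → ℝ => (Matrix.of A).det :=
    (show Continuous fun A : ι → ι → ℝ => (Matrix.of A).det from
      Continuous.matrix_det continuous_id).measurable
  have hadj : Measurable fun A : ι → ι → ℝ => (Matrix.of A).adjugate i j :=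
    (show Continuous fun A : ι → ι → ℝ => (Matrix.of A).adjugate i j from
      (Continuous.matrix_adjugate continuous_id).matrix_elem i j).measurable
  have h : (fun ω => (W ω)⁻¹ i j) = fun ω => (W ω).det⁻¹ * (W ω).adjugate i j := by
    funext ω
    rw [Matrix.inv_def, Ring.inverse_eq_inv', Matrix.smul_apply, smul_eq_mul]
  rw [h]
  exact (hdet.comp_aemeasurable hW').inv.mul (hadj.comp_aemeasurable hW')

omit [DecidableEq ι] in
lemma aemeasurable_mul_apply {α γ : Type*} {A : Ω → Matrix α ι ℝ} {B : Ω → Matrix ι γ ℝ}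
    (hA : ∀ i j, AEMeasurable (fun ω => A ω i j) P)
    (hB : ∀ i j, AEMeasurable (fun ω => B ω i j) P) (i : α) (j : γ) :
    AEMeasurable (fun ω => (A ω * B ω) i j) P := by
  simp only [Matrix.mul_apply]
  exact Finset.aemeasurable_fun_sum _ fun k _ => (hA i k).mul (hB k j)

omit [DecidableEq ι] in
lemma aemeasurable_toLp {f : Ω → ι → ℝ} (hf : ∀ i, AEMeasurable (fun ω => f ω i) P) :
    AEMeasurable (fun ω => (WithLp.toLp 2 (f ω) : EuclideanSpace ℝ ι)) P :=
  (WithLp.measurable_toLp 2 _).comp_aemeasurable (aemeasurable_pi_lambda _ hf)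

end Algebra

/-! ### The least squares estimator and its score -/

section LeastSquares

variable {ι κ : Type*} [Fintype ι] [DecidableEq ι] [Fintype κ]

lemma leastSquares_sub {X : Matrix κ ι ℝ} (hX : IsUnit (Xᵀ * X).det) (θ : EuclideanSpace ℝ ι)
    (e : κ → ℝ) :
    leastSquares X (X *ᵥ θ + e) - θ = WithLp.toLp 2 ((Xᵀ * X)⁻¹ *ᵥ (Xᵀ *ᵥ e)) := by
  ext j
  have h : ((Xᵀ * X)⁻¹ * Xᵀ) *ᵥ (X *ᵥ θ + e) = θ + (Xᵀ * X)⁻¹ *ᵥ (Xᵀ *ᵥ e) := by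
    rw [Matrix.mulVec_add, Matrix.mulVec_mulVec, Matrix.mul_assoc, Matrix.nonsing_inv_mul _ hX,
      Matrix.one_mulVec, Matrix.mulVec_mulVec]
  simp [leastSquares, h]

/-- The normalized score `n^{-1/2} X'e`. -/
noncomputable def score {n : ℕ} (X : Matrix (Fin n) ι ℝ) (e : Fin n → ℝ) : EuclideanSpace ℝ ι :=
  WithLp.toLp 2 ((√(n : ℝ))⁻¹ • (Xᵀ *ᵥ e))

lemma sqrt_smul_leastSquares_sub {n : ℕ} (hn : n ≠ 0) {X : Matrix (Fin n) ι ℝ}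
    (hX : IsUnit ((n : ℝ)⁻¹ • (Xᵀ * X)).det) (θ : EuclideanSpace ℝ ι) (e : Fin n → ℝ) :
    √(n : ℝ) • (leastSquares X (X *ᵥ θ + e) - θ) =
      WithLp.toLp 2 (((n : ℝ)⁻¹ • (Xᵀ * X))⁻¹ *ᵥ score X e) := by
  have hn' : (n : ℝ) ≠ 0 := by exact_mod_cast hn
  have hX' : IsUnit (Xᵀ * X).det := by
    rw [Matrix.det_smul] at hX
    exact isUnit_of_mul_isUnit_right hX
  have hinv : ((n : ℝ)⁻¹ • (Xᵀ * X))⁻¹ = (n : ℝ) • (Xᵀ * X)⁻¹ := by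
    refine Matrix.inv_eq_left_inv ?_
    rw [Matrix.smul_mul, Matrix.mul_smul, smul_smul, mul_inv_cancel₀ hn', one_smul,
      Matrix.nonsing_inv_mul _ hX']
  have hsqrt : (√(n : ℝ))⁻¹ * (n : ℝ) = √(n : ℝ) := by
    rw [mul_comm, ← div_eq_mul_inv, Real.div_sqrt]
  rw [leastSquares_sub hX', hinv, score]
  ext j
  simp only [Matrix.smul_mulVec, Matrix.mulVec_smul, smul_smul, hsqrt, PiLp.smul_apply,
    Pi.smul_apply]

lemma score_eq_mulVec {n : ℕ} (hn : n ≠ 0) {X : Matrix (Fin n) ι ℝ}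
    (hX : IsUnit ((n : ℝ)⁻¹ • (Xᵀ * X)).det) (θ : EuclideanSpace ℝ ι) (e : Fin n → ℝ) :
    score X e = WithLp.toLp 2 (((n : ℝ)⁻¹ • (Xᵀ * X)) *ᵥ
      (√(n : ℝ) • (leastSquares X (X *ᵥ θ + e) - θ) : EuclideanSpace ℝ ι)) := by
  rw [sqrt_smul_leastSquares_sub hn hX]
  simp [Matrix.mulVec_mulVec, Matrix.mul_nonsing_inv _ hX]

variable {Ω : Type*} [MeasurableSpace Ω] {P : Measure Ω}

omit [Fintype ι] [DecidableEq ι] in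
lemma aemeasurable_mulVec {Z : Ω → κ → ℝ} (hZ : ∀ i, AEMeasurable (fun ω => Z ω i) P)
    (A : Matrix ι κ ℝ) (j : ι) : AEMeasurable (fun ω => (A *ᵥ Z ω) j) P := by
  simp only [Matrix.mulVec, dotProduct]
  exact Finset.aemeasurable_fun_sum _ fun i _ => (hZ i).const_mul _

lemma aemeasurable_leastSquares {y : Ω → κ → ℝ} (hy : ∀ i, AEMeasurable (fun ω => y ω i) P)
    (X : Matrix κ ι ℝ) : AEMeasurable (fun ω => leastSquares X (y ω)) P :=
  aemeasurable_toLp fun j => aemeasurable_mulVec hy _ j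

omit [DecidableEq ι] in
lemma aemeasurable_score {n : ℕ} {e : Ω → Fin n → ℝ} (he : ∀ i, AEMeasurable (fun ω => e ω i) P)
    (X : Matrix (Fin n) ι ℝ) : AEMeasurable (fun ω => score X (e ω)) P :=
  aemeasurable_toLp fun j => (aemeasurable_mulVec he _ j).const_mul _

omit [Fintype ι] [DecidableEq ι] [Fintype κ] in
lemma tendstoInMeasure_const_matrix {A : ℕ → Matrix κ ι ℝ} {A₀ : Matrix κ ι ℝ}
    (hA : Tendsto A atTop (𝓝 A₀)) (i : κ) (j : ι) :
    TendstoInMeasure P (fun n _ => A n i j) atTop (fun _ => A₀ i j) := by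
  rw [tendstoInMeasure_iff_dist]
  intro ε hε
  have h : Tendsto (fun n => A n i j) atTop (𝓝 (A₀ i j)) :=
    ((continuous_id.matrix_elem i j).tendsto A₀).comp hA
  refine tendsto_const_nhds.congr' ?_
  filter_upwards [Metric.tendsto_nhds.1 h ε hε] with n hn
  simp [not_le.2 hn]

variable [IsProbabilityMeasure P]

/-- Deterministic Slutsky: convergent matrices applied to asymptotically normal vectors. -/
lemma TendstoNormal.mulVec_of_tendsto [DecidableEq κ] {T : ℕ → Ω → EuclideanSpace ℝ ι}
    {S : Matrix ι ι ℝ} (hS : S.PosSemidef) (h : TendstoNormal P T S) {A : ℕ → Matrix κ ι ℝ}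
    {A₀ : Matrix κ ι ℝ} (hA : Tendsto A atTop (𝓝 A₀)) :
    TendstoNormal P (fun n ω => WithLp.toLp 2 (A n *ᵥ T n ω)) (A₀ * S * A₀ᵀ) :=
  h.mulVec (M := fun n _ => A n) hS (fun _ _ _ => aemeasurable_const)
    (tendstoInMeasure_const_matrix hA)

variable {X : (n : ℕ) → Matrix (Fin n) ι ℝ} {S : Matrix ι ι ℝ}

lemma eventually_isUnit_det (hX : Tendsto (fun n : ℕ => (n : ℝ)⁻¹ • ((X n)ᵀ * X n)) atTop (𝓝 S))
    (hS : S.PosDef) : ∀ᶠ n : ℕ in atTop, n ≠ 0 ∧ IsUnit ((n : ℝ)⁻¹ • ((X n)ᵀ * X n)).det := by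
  have hdet : Tendsto (fun n : ℕ => ((n : ℝ)⁻¹ • ((X n)ᵀ * X n)).det) atTop (𝓝 S.det) :=
    (continuous_id.matrix_det.tendsto S).comp hX
  filter_upwards [eventually_ne_atTop 0, hdet.eventually_ne hS.det_pos.ne'] with n h0 hn
  exact ⟨h0, isUnit_iff_ne_zero.2 hn⟩

/-- The least squares estimator is asymptotically normal exactly when its score is: they differ by
the convergent deterministic factor `n⁻¹X'X`. -/
lemma tendstoNormal_leastSquares_iff_score {e : (n : ℕ) → Ω → Fin n → ℝ} {σ : ℝ}
    (he : ∀ n i, AEMeasurable (fun ω => e n ω i) P)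
    (hX : Tendsto (fun n : ℕ => (n : ℝ)⁻¹ • ((X n)ᵀ * X n)) atTop (𝓝 S)) (hS : S.PosDef)
    (θ : EuclideanSpace ℝ ι) :
    TendstoNormal P (fun n ω => √(n : ℝ) • (leastSquares (X n) (X n *ᵥ θ + e n ω) - θ))
        (σ ^ 2 • S⁻¹) ↔
      TendstoNormal P (fun n ω => score (X n) (e n ω)) (σ ^ 2 • S) := by
  have hunit : IsUnit S.det := isUnit_iff_ne_zero.2 hS.det_pos.ne'
  have hsymm : Sᵀ = S := by simpa [Matrix.IsHermitian] using hS.1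
  have hσ : (0 : ℝ) ≤ σ ^ 2 := sq_nonneg σ
  constructor
  · intro h
    have hlin := h.mulVec_of_tendsto (hS.inv.posSemidef.smul hσ) hX
    have hcov : S * (σ ^ 2 • S⁻¹) * Sᵀ = σ ^ 2 • S := by
      rw [hsymm, Matrix.mul_smul, Matrix.smul_mul, Matrix.mul_nonsing_inv _ hunit, Matrix.one_mul]
    rw [hcov] at hlin
    refine hlin.congr_of_eventually_eq (fun n => aemeasurable_score (he n) _) ?_
    filter_upwards [eventually_isUnit_det hX hS] with n hn
    funext ω
    exact score_eq_mulVec hn.1 hn.2 θ (e n ω)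
  · intro h
    have hXinv : Tendsto (fun n : ℕ => ((n : ℝ)⁻¹ • ((X n)ᵀ * X n))⁻¹) atTop (𝓝 S⁻¹) :=
      (continuousAt_matrix_inv hunit).tendsto.comp hX
    have hlin := h.mulVec_of_tendsto (hS.posSemidef.smul hσ) hXinv
    have hcov : S⁻¹ * (σ ^ 2 • S) * (S⁻¹)ᵀ = σ ^ 2 • S⁻¹ := by
      rw [Matrix.transpose_nonsing_inv, hsymm, Matrix.mul_smul, Matrix.smul_mul,
        Matrix.nonsing_inv_mul _ hunit, Matrix.one_mul]
    rw [hcov] at hlin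
    refine hlin.congr_of_eventually_eq (fun n => ?_) ?_
    · have hy : ∀ i, AEMeasurable (fun ω => (X n *ᵥ θ + e n ω) i) P := fun i =>
        (he n i).const_add _
      exact AEMeasurable.const_smul ((aemeasurable_leastSquares hy (X n)).sub_const θ) (√(n : ℝ))
    · filter_upwards [eventually_isUnit_det hX hS] with n hn
      funext ω
      exact sqrt_smul_leastSquares_sub hn.1 hn.2 θ (e n ω)

/-- The weights of the errors in the projection of the score on the direction `t`. -/
noncomputable def scoreWeight {n : ℕ} (X : Matrix (Fin n) ι ℝ) (t : EuclideanSpace ℝ ι)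
    (i : Fin n) : ℝ :=
  (√(n : ℝ))⁻¹ * (X *ᵥ t) i

omit [DecidableEq ι] in
lemma inner_score {n : ℕ} (X : Matrix (Fin n) ι ℝ) (e : Fin n → ℝ) (t : EuclideanSpace ℝ ι) :
    inner ℝ (score X e) t = ∑ i, scoreWeight X t i * e i := by
  have h : inner ℝ (score X e) t = (√(n : ℝ))⁻¹ * ((X *ᵥ t) ⬝ᵥ e) := by
    rw [score, EuclideanSpace.inner_eq_star_dotProduct, star_trivial, dotProduct_smul,
      Matrix.dotProduct_mulVec, Matrix.vecMul_transpose, smul_eq_mul]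
  rw [h, dotProduct, Finset.mul_sum]
  exact Finset.sum_congr rfl fun i _ => by rw [scoreWeight]; ring

omit [DecidableEq ι] in
lemma sum_scoreWeight_sq {n : ℕ} (X : Matrix (Fin n) ι ℝ) (t : EuclideanSpace ℝ ι) :
    ∑ i, scoreWeight X t i ^ 2 = t ⬝ᵥ (((n : ℝ)⁻¹ • (Xᵀ * X)) *ᵥ t) := by
  have h : ∀ i, scoreWeight X t i ^ 2 = (n : ℝ)⁻¹ * ((X *ᵥ t) i * (X *ᵥ t) i) := by
    intro i
    rw [scoreWeight, mul_pow, inv_pow, Real.sq_sqrt (Nat.cast_nonneg n), sq]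
  simp_rw [h]
  rw [← Finset.mul_sum, Matrix.smul_mulVec, dotProduct_smul, ← Matrix.mulVec_mulVec,
    Matrix.dotProduct_mulVec, Matrix.vecMul_transpose, smul_eq_mul, dotProduct]

omit [DecidableEq ι] in
lemma abs_scoreWeight_le {n : ℕ} (X : Matrix (Fin n) ι ℝ) (t : EuclideanSpace ℝ ι) (i : Fin n) :
    |scoreWeight X t i| ≤
      (√(n : ℝ))⁻¹ * (‖(WithLp.toLp 2 (X i) : EuclideanSpace ℝ ι)‖ * ‖t‖) := by
  have h : (X *ᵥ t) i = inner ℝ t (WithLp.toLp 2 (X i) : EuclideanSpace ℝ ι) := by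
    rw [EuclideanSpace.inner_eq_star_dotProduct, star_trivial]
    rfl
  rw [scoreWeight, abs_mul, abs_of_nonneg (inv_nonneg.2 (Real.sqrt_nonneg _)), h]
  refine mul_le_mul_of_nonneg_left ?_ (inv_nonneg.2 (Real.sqrt_nonneg _))
  rw [mul_comm]
  exact abs_real_inner_le_norm _ _

omit [DecidableEq ι] [IsProbabilityMeasure P] in
/-- The Lindeberg condition on the rows of the design implies the one for every projection. -/
lemma tendsto_sum_truncMoment_of_lindeberg {ε : (n : ℕ) → Fin n → Ω → ℝ}
    (hL2 : ∀ n i, MemLp (ε n i) 2 P) (hlind : LindebergCondition P X ε)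
    (t : EuclideanSpace ℝ ι) {δ : ℝ} (hδ : 0 < δ) :
    Tendsto (fun n => ∑ i, truncMoment P (ε n i) (scoreWeight (X n) t i) δ) atTop (𝓝 0) := by
  -- adding one keeps the factor positive when `t = 0`
  set K := ‖t‖ + 1 with hK
  have hK0 : 0 < K := by positivity
  have hlim := (hlind (δ / K) (by positivity)).const_mul (K ^ 2)
  rw [mul_zero] at hlim
  refine squeeze_zero (fun n => Finset.sum_nonneg fun i _ => truncMoment_nonneg _ _ _)
    (fun n => ?_) hlim
  rw [← mul_assoc, Finset.mul_sum]
  refine Finset.sum_le_sum fun i _ => ?_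
  have hn : (0 : ℝ) < n := by
    have : 0 < n := i.pos
    exact_mod_cast this
  set x : ℝ := ‖(WithLp.toLp 2 (X n i) : EuclideanSpace ℝ ι)‖ with hx
  have hx0 : 0 ≤ x := norm_nonneg _
  have hs : 0 < √(n : ℝ) := Real.sqrt_pos.2 hn
  have hw : |scoreWeight (X n) t i| ≤ (√(n : ℝ))⁻¹ * (x * K) := by
    refine (abs_scoreWeight_le (X n) t i).trans ?_
    gcongr
    linarith
  have hw2 : scoreWeight (X n) t i ^ 2 ≤ K ^ 2 * (n : ℝ)⁻¹ * x ^ 2 := by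
    rw [← sq_abs]
    refine (pow_le_pow_left₀ (abs_nonneg _) hw 2).trans (le_of_eq ?_)
    rw [mul_pow, inv_pow, Real.sq_sqrt hn.le]
    ring
  have hxint := integrable_indicator_sq (hL2 n i) x 1 (δ / K * √(n : ℝ))
  simp only [one_mul] at hxint
  have hwint := integrable_indicator_sq (hL2 n i) 1 (scoreWeight (X n) t i) δ
  simp only [one_mul] at hwint
  rw [← mul_assoc, ← integral_const_mul, truncMoment]
  refine integral_mono hwint (hxint.const_mul _) fun ω => ?_
  simp only [Set.indicator_apply, Set.mem_ofPred_eq]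
  by_cases h : δ < |scoreWeight (X n) t i * ε n i ω|
  · have h' : δ / K * √(n : ℝ) < x * |ε n i ω| := by
      rw [abs_mul] at h
      have h1 : δ < (√(n : ℝ))⁻¹ * (x * K) * |ε n i ω| :=
        h.trans_le (mul_le_mul_of_nonneg_right hw (abs_nonneg _))
      rw [div_mul_eq_mul_div, div_lt_iff₀ hK0]
      have h2 : (√(n : ℝ))⁻¹ * (x * K) * |ε n i ω| * √(n : ℝ) = x * |ε n i ω| * K := by
        field_simp
      rw [← h2]
      exact mul_lt_mul_of_pos_right h1 hs
    rw [if_pos h, if_pos h', mul_pow]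
    exact mul_le_mul_of_nonneg_right hw2 (sq_nonneg _)
  · rw [if_neg h]
    split_ifs <;> positivity

/-- Multivariate Lindeberg theorem for the score, by the Cramér–Wold device in the form of Lévy's
continuity theorem. -/
lemma tendstoNormal_score {ε : (n : ℕ) → Fin n → Ω → ℝ} {σ : ℝ}
    (hL2 : ∀ n i, MemLp (ε n i) 2 P) (hmean : ∀ n i, ∫ ω, ε n i ω ∂P = 0)
    (hvar : ∀ n i, ∫ ω, ε n i ω ^ 2 ∂P = σ ^ 2) (hind : ∀ n, iIndepFun (ε n) P)
    (hX : Tendsto (fun n : ℕ => (n : ℝ)⁻¹ • ((X n)ᵀ * X n)) atTop (𝓝 S)) (hS : S.PosDef)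
    (hlind : LindebergCondition P X ε) :
    TendstoNormal P (fun n ω => score (X n) (fun i => ε n i ω)) (σ ^ 2 • S) := by
  have hmeas : ∀ n, AEMeasurable (fun ω => score (X n) (fun i => ε n i ω)) P := fun n =>
    aemeasurable_score (fun i => (hL2 n i).aemeasurable) _
  refine ⟨hmeas, aemeasurable_id, ProbabilityMeasure.tendsto_iff_tendsto_charFun.2 fun t => ?_⟩
  simp only [ProbabilityMeasure.coe_mk, Measure.map_id]
  rw [charFun_multivariateGaussian (hS.posSemidef.smul (sq_nonneg σ))]
  have hv : Tendsto (fun n => σ ^ 2 * ∑ i, scoreWeight (X n) t i ^ 2) atTop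
      (𝓝 (σ ^ 2 * (t ⬝ᵥ (S *ᵥ t)))) := by
    simp_rw [sum_scoreWeight_sq]
    refine Tendsto.const_mul _ ?_
    exact ((continuous_const.dotProduct (continuous_id.matrix_mulVec continuous_const)).tendsto
      S).comp hX
  have key := tendsto_charFun_weighted_sum hL2 hmean hvar hind hv fun δ hδ =>
    tendsto_sum_truncMoment_of_lindeberg hL2 hlind t hδ
  convert key using 2 with n
  · rw [charFun_apply, integral_map (hmeas n) (by fun_prop)]
    simp_rw [inner_score]
  · congr 1
    simp [Matrix.smul_mulVec, dotProduct_smul]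
    ring

end LeastSquares

/-! ### The oracle Hodges' estimator -/

section Hodges

variable {ι : Type*} [Fintype ι] [DecidableEq ι]

/-- The linear map that sends the estimation error of the base estimator to that of the adjusted
estimator with selected set `b`, when the parameter agrees with the center outside `b`. -/
noncomputable def adjustMatrix (b : Finset ι) (V : Matrix ι ι ℝ) : Matrix ι ι ℝ :=
  (coordProj (· ∈ b))ᵀ *
    (coordProj (· ∈ b) + (blockIn V b)⁻¹ * blockOff V b * coordProj (· ∉ b))

lemma adjusted_sub_eq_adjustMatrix_mulVec {b : Finset ι} {θ c : EuclideanSpace ℝ ι}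
    (hθ : ∀ j, j ∉ b → θ j = c j) (V : Matrix ι ι ℝ) (t : EuclideanSpace ℝ ι) :
    adjusted V t c b - θ =
      WithLp.toLp 2 (adjustMatrix b V *ᵥ (t - θ : EuclideanSpace ℝ ι)) := by
  ext j
  have hout : (fun i : {i // i ∉ b} => t i - c i) =
      coordProj (· ∉ b) *ᵥ (t - θ : EuclideanSpace ℝ ι) := by
    funext i
    rw [coordProj_mulVec, PiLp.sub_apply, hθ i i.2]
  rw [adjustMatrix, ← Matrix.mulVec_mulVec]
  change _ = ((coordProj (· ∈ b))ᵀ *ᵥ _) j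
  rw [coordProj_transpose_mulVec, PiLp.sub_apply, adjusted, PiLp.toLp_apply]
  split_ifs with h
  · rw [hout, Matrix.add_mulVec, Pi.add_apply, coordProj_mulVec, Matrix.mulVec_mulVec,
      PiLp.sub_apply]
    ring
  · rw [hθ j h, sub_self]

/-- When `V_bb` is invertible, the adjustment map is `diag(V_bb⁻¹, 0) V`. -/
lemma adjustMatrix_eq {b : Finset ι} {V : Matrix ι ι ℝ} (hV : IsUnit (blockIn V b).det) :
    adjustMatrix b V = (coordProj (· ∈ b))ᵀ * (blockIn V b)⁻¹ * coordProj (· ∈ b) * V := by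
  have h : coordProj (· ∈ b) * V =
      blockIn V b * coordProj (· ∈ b) + blockOff V b * coordProj (· ∉ b) := by
    rw [← coordProj_mul_mul_transpose, ← coordProj_mul_mul_transpose_compl]
    conv_lhs => rw [← Matrix.mul_one (coordProj (· ∈ b) * V),
      ← coordProj_transpose_mul_add_compl b, Matrix.mul_add]
    simp only [Matrix.mul_assoc]
  have h' : (blockIn V b)⁻¹ * (coordProj (· ∈ b) * V) =
      coordProj (· ∈ b) + (blockIn V b)⁻¹ * blockOff V b * coordProj (· ∉ b) := by
    rw [h, Matrix.mul_add, ← Matrix.mul_assoc, Matrix.nonsing_inv_mul _ hV, Matrix.one_mul,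
      ← Matrix.mul_assoc]
  rw [adjustMatrix, ← h']
  simp only [Matrix.mul_assoc]

/-- Conditioning removes the nuisance part of the covariance: the adjustment map with
`V = Γ⁻¹` carries the covariance `Γ` to `diag(V_bb⁻¹, 0)`. -/
lemma adjustMatrix_mul_mul_transpose {V : Matrix ι ι ℝ} (hV : V.PosDef) (b : Finset ι) :
    adjustMatrix b V * V⁻¹ * (adjustMatrix b V)ᵀ = padZero b (blockIn V b)⁻¹ := by
  have hVu : IsUnit V.det := isUnit_iff_ne_zero.2 hV.det_pos.ne'
  have hb := posDef_blockIn hV b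
  have hbu : IsUnit (blockIn V b).det := isUnit_iff_ne_zero.2 hb.det_pos.ne'
  have hbs : (blockIn V b)ᵀ = blockIn V b := by simpa [Matrix.IsHermitian] using hb.1
  have hVs : Vᵀ = V := by simpa [Matrix.IsHermitian] using hV.1
  have h1 : adjustMatrix b V * V⁻¹ =
      (coordProj (· ∈ b))ᵀ * (blockIn V b)⁻¹ * coordProj (· ∈ b) := by
    rw [adjustMatrix_eq hbu, Matrix.mul_assoc _ V, Matrix.mul_nonsing_inv _ hVu, Matrix.mul_one]
  have h2 : (adjustMatrix b V)ᵀ =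
      V * ((coordProj (· ∈ b))ᵀ * ((blockIn V b)⁻¹ * coordProj (· ∈ b))) := by
    rw [adjustMatrix_eq hbu]
    simp only [Matrix.transpose_mul, Matrix.transpose_transpose, Matrix.transpose_nonsing_inv, hbs,
      hVs]
  rw [h1, h2, padZero_eq]
  calc _ = (coordProj (· ∈ b))ᵀ * (blockIn V b)⁻¹ *
        (coordProj (· ∈ b) * V * (coordProj (· ∈ b))ᵀ) *
        ((blockIn V b)⁻¹ * coordProj (· ∈ b)) := by simp only [Matrix.mul_assoc]
    _ = _ := by
      rw [coordProj_mul_mul_transpose, Matrix.mul_assoc _ _ (blockIn V b),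
        Matrix.nonsing_inv_mul _ hbu, Matrix.mul_one, ← Matrix.mul_assoc]

lemma continuousAt_adjustMatrix {b : Finset ι} {V : Matrix ι ι ℝ}
    (hV : IsUnit (blockIn V b).det) : ContinuousAt (adjustMatrix b) V := by
  have hin : Continuous fun M : Matrix ι ι ℝ => blockIn M b :=
    continuous_id.matrix_submatrix _ _
  have hoff : Continuous fun M : Matrix ι ι ℝ => blockOff M b :=
    continuous_id.matrix_submatrix _ _
  have hinv : ContinuousAt (fun M : Matrix ι ι ℝ => (blockIn M b)⁻¹) V :=
    (continuousAt_matrix_inv hV).comp_of_eq hin.continuousAt rfl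
  have hg : Continuous fun p : Matrix {j // j ∈ b} {j // j ∈ b} ℝ ×
      Matrix {j // j ∈ b} {j // j ∉ b} ℝ =>
      (coordProj (· ∈ b))ᵀ * (coordProj (· ∈ b) + p.1 * p.2 * coordProj (· ∉ b)) :=
    continuous_const.matrix_mul (continuous_const.add
      ((continuous_fst.matrix_mul continuous_snd).matrix_mul continuous_const))
  exact hg.continuousAt.comp (f := fun M => ((blockIn M b)⁻¹, blockOff M b))
    (hinv.prodMk hoff.continuousAt)

section Probability

variable {Ω : Type*} [MeasurableSpace Ω] {P : Measure Ω}

omit [Fintype ι] in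
lemma aemeasurable_inv_mul_blockOff_apply {V : Ω → Matrix ι ι ℝ}
    (hV : ∀ i j, AEMeasurable (fun ω => V ω i j) P) (b : Finset ι) (i : {j // j ∈ b})
    (j : {j // j ∉ b}) :
    AEMeasurable (fun ω => ((blockIn (V ω) b)⁻¹ * blockOff (V ω) b) i j) P :=
  aemeasurable_mul_apply
    (aemeasurable_inv_apply (W := fun ω => blockIn (V ω) b) fun i j => hV i j)
    (fun i j => hV i j) i j

lemma aemeasurable_adjustMatrix_apply {V : Ω → Matrix ι ι ℝ}
    (hV : ∀ i j, AEMeasurable (fun ω => V ω i j) P) (b : Finset ι) (i j : ι) :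
    AEMeasurable (fun ω => adjustMatrix b (V ω) i j) P := by
  have hcorr : ∀ k l, AEMeasurable (fun ω => (coordProj (· ∈ b) +
      (blockIn (V ω) b)⁻¹ * blockOff (V ω) b * coordProj (· ∉ b)) k l) P := by
    intro k l
    have h : AEMeasurable (fun ω =>
        ((blockIn (V ω) b)⁻¹ * blockOff (V ω) b * coordProj (· ∉ b)) k l) P :=
      aemeasurable_mul_apply (A := fun ω => (blockIn (V ω) b)⁻¹ * blockOff (V ω) b)
        (B := fun _ => coordProj (· ∉ b)) (aemeasurable_inv_mul_blockOff_apply hV b)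
        (fun _ _ => aemeasurable_const) k l
    exact h.const_add _
  exact aemeasurable_mul_apply (A := fun _ => (coordProj (· ∈ b))ᵀ)
    (fun _ _ => aemeasurable_const) hcorr i j

lemma aemeasurable_adjusted {V : Ω → Matrix ι ι ℝ} (hV : ∀ i j, AEMeasurable (fun ω => V ω i j) P)
    {t : Ω → EuclideanSpace ℝ ι} (ht : AEMeasurable t P) (c : EuclideanSpace ℝ ι) (b : Finset ι) :
    AEMeasurable (fun ω => adjusted (V ω) (t ω) c b) P := by
  have ht' : ∀ j, AEMeasurable (fun ω => t ω j) P := fun j => by fun_prop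
  refine aemeasurable_toLp fun j => ?_
  by_cases h : j ∈ b
  · simp only [h, dif_pos, Matrix.mulVec, dotProduct]
    refine (ht' j).add (Finset.aemeasurable_fun_sum _ fun i _ => ?_)
    refine AEMeasurable.mul ?_ ((ht' i).sub_const _)
    exact aemeasurable_inv_mul_blockOff_apply hV b _ _
  · simp only [h, dif_neg, not_false_eq_true]
    exact aemeasurable_const

/-- The oracle Hodges' estimator is a finite sum over the possible selected sets. -/
lemma aemeasurable_oracleHodges {V : Ω → Matrix ι ι ℝ}
    (hV : ∀ i j, AEMeasurable (fun ω => V ω i j) P) {t : Ω → EuclideanSpace ℝ ι}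
    (ht : AEMeasurable t P) (c : EuclideanSpace ℝ ι) (a : ι → ℝ) :
    AEMeasurable (fun ω => oracleHodges (V ω) (t ω) c a) P := by
  have ht' : ∀ j, AEMeasurable (fun ω => t ω j) P := fun j => by fun_prop
  have hset : ∀ b : Finset ι, NullMeasurableSet {ω | selectedSet (t ω) c a = b} P := by
    intro b
    have : {ω | selectedSet (t ω) c a = b} =
        ⋂ j, {ω | a j < |t ω j - c j| ↔ j ∈ b} := by
      ext ω
      simp [selectedSet, Finset.ext_iff]
    rw [this]
    refine NullMeasurableSet.iInter fun j => ?_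
    by_cases hj : j ∈ b
    · simp only [hj, iff_true]
      exact nullMeasurableSet_lt aemeasurable_const (by fun_prop)
    · simp only [hj, iff_false, not_lt]
      exact nullMeasurableSet_le (by fun_prop) aemeasurable_const
  have hsum : (fun ω => oracleHodges (V ω) (t ω) c a) = fun ω => ∑ b : Finset ι,
      Set.indicator {ω | selectedSet (t ω) c a = b} (fun ω => adjusted (V ω) (t ω) c b) ω := by
    funext ω
    simp [Set.indicator_apply, oracleHodges]
  rw [hsum]
  exact Finset.aemeasurable_fun_sum _ fun b _ =>
    (aemeasurable_adjusted hV ht c b).indicator₀ (hset b)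

variable [IsProbabilityMeasure P]

/-- Selection consistency: thresholds that vanish more slowly than `n^{-1/2}` separate the zero
from the nonzero coordinates of `θ - c`, since `√n (t - θ)` is bounded in probability. -/
lemma tendsto_measure_selectedSet_ne {t : ℕ → Ω → EuclideanSpace ℝ ι} {θ : EuclideanSpace ℝ ι}
    {Γ : Matrix ι ι ℝ} (h : TendstoNormal P (fun n ω => √(n : ℝ) • (t n ω - θ)) Γ)
    (c : EuclideanSpace ℝ ι) {a : ℕ → ι → ℝ} (ha : ∀ j, Tendsto (fun n => a n j) atTop (𝓝 0))
    (ha' : ∀ j, Tendsto (fun n : ℕ => √(n : ℝ) * a n j) atTop atTop) :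
    Tendsto (fun n => P {ω | selectedSet (t n ω) c (a n) ≠ activeSet θ c}) atTop (𝓝 0) := by
  have hcoord : ∀ j, Tendsto (fun n => P {ω | ¬(a n j < |t n ω j - c j| ↔ θ j ≠ c j)}) atTop
      (𝓝 0) := by
    intro j
    have hnorm : ∀ (n : ℕ) ω, √(n : ℝ) * |t n ω j - θ j| ≤ ‖√(n : ℝ) • (t n ω - θ)‖ := by
      intro n ω
      have := PiLp.norm_apply_le (√(n : ℝ) • (t n ω - θ)) j
      rwa [PiLp.smul_apply, PiLp.sub_apply, norm_smul, Real.norm_eq_abs, Real.norm_eq_abs,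
        abs_of_nonneg (Real.sqrt_nonneg _)] at this
    by_cases hj : θ j = c j
    · refine tendsto_of_tendsto_of_tendsto_of_le_of_le tendsto_const_nhds
        (tendsto_measure_le_norm_of_tendstoInDistribution h (ha' j)) (fun _ => zero_le)
        fun n => measure_mono fun ω hω => ?_
      simp only [ne_eq, hj, not_true_eq_false, iff_false, not_not, Set.mem_ofPred_eq] at hω
      rw [← hj] at hω
      exact (mul_le_mul_of_nonneg_left hω.le (Real.sqrt_nonneg _)).trans (hnorm n ω)
    · have hr : Tendsto (fun n : ℕ => √(n : ℝ) * (|θ j - c j| - a n j)) atTop atTop := by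
        refine Tendsto.atTop_mul_pos (C := |θ j - c j|) (abs_pos.2 (sub_ne_zero.2 hj))
          (Real.tendsto_sqrt_atTop.comp tendsto_natCast_atTop_atTop) ?_
        simpa using tendsto_const_nhds.sub (ha j)
      refine tendsto_of_tendsto_of_tendsto_of_le_of_le tendsto_const_nhds
        (tendsto_measure_le_norm_of_tendstoInDistribution h hr) (fun _ => zero_le)
        fun n => measure_mono fun ω hω => ?_
      simp only [ne_eq, hj, not_false_eq_true, iff_true, not_lt, Set.mem_ofPred_eq] at hω
      refine le_trans (mul_le_mul_of_nonneg_left ?_ (Real.sqrt_nonneg _)) (hnorm n ω)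
      have := abs_sub_le (θ j) (t n ω j) (c j)
      rw [abs_sub_comm (θ j) (t n ω j)] at this
      linarith
  have hsum := tendsto_finsetSum (Finset.univ : Finset ι) fun j _ => hcoord j
  rw [Finset.sum_const_zero] at hsum
  refine tendsto_of_tendsto_of_tendsto_of_le_of_le tendsto_const_nhds hsum (fun _ => zero_le)
    fun n => (measure_mono fun ω hω => ?_).trans (measure_iUnion_fintype_le P _)
  by_contra hcon
  refine hω (Finset.ext fun j => ?_)
  simp only [Set.mem_iUnion, Set.mem_ofPred_eq, not_exists, not_not] at hcon
  simpa [selectedSet, activeSet] using hcon j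

lemma tendsto_measure_oracleHodges_eq {V : ℕ → Ω → Matrix ι ι ℝ}
    {t : ℕ → Ω → EuclideanSpace ℝ ι} {θ c : EuclideanSpace ℝ ι} {a : ℕ → ι → ℝ}
    (hsel : Tendsto (fun n => P {ω | selectedSet (t n ω) c (a n) ≠ activeSet θ c}) atTop (𝓝 0))
    {b : Finset ι} (hb : ∀ j, j ∉ b → θ j = c j) :
    Tendsto (fun n => P {ω | ∀ j, j ∉ b → oracleHodges (V n ω) (t n ω) c (a n) j = θ j}) atTop
      (𝓝 1) := by
  refine tendsto_measure_one_of_compl (tendsto_of_tendsto_of_tendsto_of_le_of_le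
    tendsto_const_nhds hsel (fun _ => zero_le) fun n => measure_mono fun ω hω heq => hω ?_)
  intro j hj
  have hj' : j ∉ activeSet θ c := by simp [activeSet, hb j hj]
  rw [oracleHodges, heq, adjusted, PiLp.toLp_apply, dif_neg hj', hb j hj]

/-- The oracle property: on the event of correct selection the estimation error is the image of
the error of the base estimator under a random linear map that converges in probability. -/
lemma tendstoNormal_oracleHodges {W : ℕ → Ω → Matrix ι ι ℝ} {t : ℕ → Ω → EuclideanSpace ℝ ι}
    {θ c : EuclideanSpace ℝ ι} {a : ℕ → ι → ℝ} {Γ : Matrix ι ι ℝ} (hΓ : Γ.PosDef)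
    (ht : ∀ n, AEMeasurable (t n) P)
    (h : TendstoNormal P (fun n ω => √(n : ℝ) • (t n ω - θ)) Γ)
    (hWm : ∀ n i j, AEMeasurable (fun ω => W n ω i j) P)
    (hW : ∀ i j, TendstoInMeasure P (fun n ω => W n ω i j) atTop (fun _ => Γ i j))
    (hsel : Tendsto (fun n => P {ω | selectedSet (t n ω) c (a n) ≠ activeSet θ c}) atTop (𝓝 0)) :
    TendstoNormal P
      (fun n ω => √(n : ℝ) • (oracleHodges (W n ω)⁻¹ (t n ω) c (a n) - θ))
      (padZero (activeSet θ c) (blockIn Γ⁻¹ (activeSet θ c))⁻¹) := by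
  set b := activeSet θ c with hb
  have hθ : ∀ j, j ∉ b → θ j = c j := fun j hj => by simpa [hb, activeSet] using hj
  have hΓu : IsUnit Γ.det := isUnit_iff_ne_zero.2 hΓ.det_pos.ne'
  have hbu : IsUnit (blockIn Γ⁻¹ b).det :=
    isUnit_iff_ne_zero.2 (posDef_blockIn hΓ.inv b).det_pos.ne'
  have hcont : ContinuousAt (fun M : Matrix ι ι ℝ => adjustMatrix b M⁻¹) Γ :=
    (continuousAt_adjustMatrix hbu).comp (f := fun M : Matrix ι ι ℝ => M⁻¹)
      (continuousAt_matrix_inv hΓu)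
  have hG : ∀ i j, TendstoInMeasure P (fun n ω => adjustMatrix b (W n ω)⁻¹ i j) atTop
      (fun _ => adjustMatrix b Γ⁻¹ i j) := fun i j =>
    tendstoInMeasure_comp_of_continuousAt hW (f := fun M => adjustMatrix b M⁻¹ i j)
      ((continuous_id.matrix_elem i j).continuousAt.comp hcont)
  have hGm : ∀ n i j, AEMeasurable (fun ω => adjustMatrix b (W n ω)⁻¹ i j) P := fun n =>
    aemeasurable_adjustMatrix_apply (aemeasurable_inv_apply (hWm n)) b
  have hlin := h.mulVec hΓ.posSemidef hGm hG
  have hcov := adjustMatrix_mul_mul_transpose hΓ.inv b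
  rw [Matrix.nonsing_inv_nonsing_inv _ hΓu] at hcov
  rw [hcov] at hlin
  refine hlin.congr_of_tendsto_measure_ne (fun n => ?_) ?_
  · exact AEMeasurable.const_smul ((aemeasurable_oracleHodges (aemeasurable_inv_apply (hWm n))
      (ht n) c (a n)).sub_const θ) (√(n : ℝ))
  · refine tendsto_of_tendsto_of_tendsto_of_le_of_le tendsto_const_nhds hsel (fun _ => zero_le)
      fun n => measure_mono fun ω hω heq => hω ?_
    rw [oracleHodges, heq, adjusted_sub_eq_adjustMatrix_mulVec hθ]
    ext j
    simp [Matrix.mulVec_smul]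

lemma TendstoNormal.subvec {T : ℕ → Ω → EuclideanSpace ℝ ι} {Γ : Matrix ι ι ℝ}
    (hΓ : Γ.PosSemidef) (h : TendstoNormal P T Γ) (b : Finset ι) :
    TendstoNormal P (fun n ω => subvec b (T n ω)) (blockIn Γ b) := by
  have hlin := h.mulVec_of_tendsto hΓ
    (tendsto_const_nhds (x := (coordProj (· ∈ b) : Matrix _ ι ℝ)))
  rw [coordProj_mul_mul_transpose] at hlin
  convert hlin using 4 with n ω
  funext j
  exact (coordProj_mulVec _ _ j).symm

omit [Fintype ι] [DecidableEq ι] in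
lemma score_colsIn {n : ℕ} (X : Matrix (Fin n) ι ℝ) (e : Fin n → ℝ) (b : Finset ι) :
    score (colsIn X b) e = subvec b (score X e) := by
  ext j
  simp [score, OracleHodges.subvec, colsIn, Matrix.mulVec, dotProduct]

end Probability

lemma blockIn_padZero (b : Finset ι) (A : Matrix {j // j ∈ b} {j // j ∈ b} ℝ) :
    blockIn (padZero b A) b = A := by
  rw [← coordProj_mul_mul_transpose, padZero_eq]
  calc _ = (coordProj (· ∈ b) * (coordProj (· ∈ b))ᵀ) * A *
        (coordProj (· ∈ b) * (coordProj (· ∈ b))ᵀ) := by simp only [Matrix.mul_assoc]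
    _ = A := by rw [coordProj_mul_transpose_self, Matrix.one_mul, Matrix.mul_one]

lemma posSemidef_padZero {b : Finset ι} {A : Matrix {j // j ∈ b} {j // j ∈ b} ℝ}
    (hA : A.PosSemidef) : (padZero b A).PosSemidef := by
  rw [padZero_eq]
  simpa using hA.conjTranspose_mul_mul_same (coordProj (· ∈ b))

end Hodges

end OracleHodges

theorem theorem4 {Ω : Type*} [MeasurableSpace Ω] (P : Measure Ω) [IsProbabilityMeasure P]
    (d : ℕ) (X : (n : ℕ) → Matrix (Fin n) (Fin d) ℝ) (ε Y : (n : ℕ) → Fin n → Ω → ℝ)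
    (β : EuclideanSpace ℝ (Fin d)) (σ : ℝ) (S : Matrix (Fin d) (Fin d) ℝ)
    -- the linear model `Y = Xβ + ε`, `E[ε] = 0`, `Var(ε) = σ² I`
    (hσ : 0 < σ)
    (hY : ∀ n i ω, Y n i ω = (X n *ᵥ ⇑β) i + ε n i ω)
    (hL2 : ∀ n i, MemLp (ε n i) 2 P)
    (hmean : ∀ n i, ∫ ω, ε n i ω ∂P = 0)
    (hcov : ∀ n i k, cov[ε n i, ε n k; P] = if i = k then σ ^ 2 else 0)
    -- `S = lim n⁻¹ X'X` is nonsingular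
    (hX : Tendsto (fun n : ℕ => (n : ℝ)⁻¹ • ((X n)ᵀ * X n)) atTop (𝓝 S))
    (hS : S.PosDef) :
    -- asymptotic normality of the least squares estimator under standard regularity conditions
    ((∀ n, iIndepFun (ε n) P) → OracleHodges.LindebergCondition P X ε →
      OracleHodges.TendstoNormal P
        (fun n ω => √(n : ℝ) • (OracleHodges.leastSquares (X n) (fun i => Y n i ω) - β))
        (σ ^ 2 • S⁻¹)) ∧
    -- whenever the least squares estimator is asymptotically normal:
    (OracleHodges.TendstoNormal P
        (fun n ω => √(n : ℝ) • (OracleHodges.leastSquares (X n) (fun i => Y n i ω) - β))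
        (σ ^ 2 • S⁻¹) →
      ∀ (c : EuclideanSpace ℝ (Fin d)) (a : ℕ → Fin d → ℝ)
        (W : ℕ → Ω → Matrix (Fin d) (Fin d) ℝ),
        (∀ j, Tendsto (fun n => a n j) atTop (𝓝 0)) →
        (∀ j, Tendsto (fun n : ℕ => √(n : ℝ) * a n j) atTop atTop) →
        -- `W n` is a consistent estimator of the asymptotic covariance matrix `σ² S⁻¹`
        (∀ n i j, AEMeasurable (fun ω => W n ω i j) P) →
        (∀ i j, TendstoInMeasure P (fun n ω => W n ω i j) atTop
          (fun _ => (σ ^ 2 • S⁻¹) i j)) →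
        let βtilde : ℕ → Ω → EuclideanSpace ℝ (Fin d) := fun n ω =>
          OracleHodges.oracleHodges (W n ω)⁻¹
            (OracleHodges.leastSquares (X n) (fun i => Y n i ω)) c (a n)
        let b₀ : Finset (Fin d) := OracleHodges.activeSet β c
        (∀ b : Finset (Fin d), (∀ j, j ∉ b → β j = c j) →
          Tendsto (fun n => P {ω | ∀ j, j ∉ b → βtilde n ω j = β j}) atTop (𝓝 1)) ∧
        Tendsto (fun n : ℕ => (n : ℝ)⁻¹ •
            ((OracleHodges.colsIn (X n) b₀)ᵀ * OracleHodges.colsIn (X n) b₀)) atTop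
          (𝓝 (OracleHodges.blockIn S b₀)) ∧
        OracleHodges.TendstoNormal P (fun n ω => √(n : ℝ) • (βtilde n ω - β))
          (OracleHodges.padZero b₀ (σ ^ 2 • (OracleHodges.blockIn S b₀)⁻¹)) ∧
        -- the oracle least squares estimator has the same asymptotic distribution
        OracleHodges.TendstoNormal P
          (fun n ω => √(n : ℝ) •
            (OracleHodges.subvec b₀ (βtilde n ω) - OracleHodges.subvec b₀ β))
          (σ ^ 2 • (OracleHodges.blockIn S b₀)⁻¹) ∧
        OracleHodges.TendstoNormal P
          (fun n ω => √(n : ℝ) •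
            (OracleHodges.oracleLeastSquares (X n) (fun i => Y n i ω) c b₀ -
              OracleHodges.subvec b₀ β))
          (σ ^ 2 • (OracleHodges.blockIn S b₀)⁻¹)) := by
  have hεm : ∀ n i, AEMeasurable (fun ω => ε n i ω) P := fun n i => (hL2 n i).aemeasurable
  have hYm : ∀ n i, AEMeasurable (fun ω => Y n i ω) P := fun n i => by
    simp_rw [hY]
    exact (hεm n i).const_add _
  have hYeq : ∀ n ω, (fun i => Y n i ω) = X n *ᵥ β + fun i => ε n i ω := fun n ω =>
    funext fun i => hY n i ω
  have hvar : ∀ n i, ∫ ω, ε n i ω ^ 2 ∂P = σ ^ 2 := by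
    intro n i
    have h := hcov n i i
    rw [if_pos rfl, covariance_self (hεm n i),
      variance_of_integral_eq_zero (hεm n i) (hmean n i)] at h
    exact h
  have hiff := OracleHodges.tendstoNormal_leastSquares_iff_score (σ := σ) hεm hX hS β
  refine ⟨fun hind hlind => ?_, fun hLSE c a W ha ha' hWm hW => ?_⟩
  · simp_rw [hYeq]
    exact hiff.2 (OracleHodges.tendstoNormal_score hL2 hmean hvar hind hX hS hlind)
  intro βtilde b₀
  have hσ2 : (0 : ℝ) < σ ^ 2 := by positivity
  have hSu : IsUnit S.det := isUnit_iff_ne_zero.2 hS.det_pos.ne'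
  have hSb := OracleHodges.posDef_blockIn hS b₀
  have hΓ : (σ ^ 2 • S⁻¹).PosDef := hS.inv.smul hσ2
  have hblock : (OracleHodges.blockIn (σ ^ 2 • S⁻¹)⁻¹ b₀)⁻¹ =
      σ ^ 2 • (OracleHodges.blockIn S b₀)⁻¹ := by
    have h1 : (σ ^ 2 • S⁻¹)⁻¹ = (σ ^ 2)⁻¹ • S := by
      refine Matrix.inv_eq_left_inv ?_
      rw [Matrix.smul_mul, Matrix.mul_smul, smul_smul, inv_mul_cancel₀ hσ2.ne', one_smul,
        Matrix.mul_nonsing_inv _ hSu]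
    have h2 : OracleHodges.blockIn ((σ ^ 2)⁻¹ • S) b₀ =
        (σ ^ 2)⁻¹ • OracleHodges.blockIn S b₀ := rfl
    rw [h1, h2]
    refine Matrix.inv_eq_left_inv ?_
    rw [Matrix.smul_mul, Matrix.mul_smul, smul_smul, mul_inv_cancel₀ hσ2.ne', one_smul,
      Matrix.nonsing_inv_mul _ (isUnit_iff_ne_zero.2 hSb.det_pos.ne')]
  have hsel := OracleHodges.tendsto_measure_selectedSet_ne hLSE c ha ha'
  have hXb : Tendsto (fun n : ℕ => (n : ℝ)⁻¹ •
      ((OracleHodges.colsIn (X n) b₀)ᵀ * OracleHodges.colsIn (X n) b₀)) atTop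
      (𝓝 (OracleHodges.blockIn S b₀)) := by
    simp_rw [OracleHodges.colsIn_transpose_mul_colsIn]
    have hcont : Continuous fun M : Matrix (Fin d) (Fin d) ℝ => OracleHodges.blockIn M b₀ :=
      continuous_id.matrix_submatrix _ _
    exact (hcont.tendsto S).comp hX
  have htilde : OracleHodges.TendstoNormal P (fun n ω => √(n : ℝ) • (βtilde n ω - β))
      (OracleHodges.padZero b₀ (σ ^ 2 • (OracleHodges.blockIn S b₀)⁻¹)) := by
    rw [← hblock]
    exact OracleHodges.tendstoNormal_oracleHodges hΓ
      (fun n => OracleHodges.aemeasurable_leastSquares (hYm n) (X n)) hLSE hWm hW hsel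
  refine ⟨fun b hb => OracleHodges.tendsto_measure_oracleHodges_eq hsel hb, hXb, htilde, ?_, ?_⟩
  · have hsub := htilde.subvec (OracleHodges.posSemidef_padZero
      (hSb.inv.posSemidef.smul hσ2.le)) b₀
    rw [OracleHodges.blockIn_padZero] at hsub
    exact hsub
  · -- in the true submodel the response is again a linear model, with the same errors
    have hsubmodel : ∀ n ω, ((fun i => Y n i ω) -
        OracleHodges.colsOut (X n) b₀ *ᵥ fun j : {j // j ∉ b₀} => c j) =
        OracleHodges.colsIn (X n) b₀ *ᵥ (OracleHodges.subvec b₀ β) + fun i => ε n i ω := by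
      intro n ω
      have hc : (fun j : {j // j ∉ b₀} => c j) = fun j : {j // j ∉ b₀} => β j := by
        funext j
        have := j.2
        simp only [b₀, OracleHodges.activeSet, Finset.mem_filter_univ, not_not] at this
        exact this.symm
      rw [hc, hYeq, ← OracleHodges.colsIn_mulVec_add_colsOut_mulVec (X n) b₀ β,
        OracleHodges.subvec]
      abel
    simp_rw [hYeq] at hLSE
    have hscore := (hiff.1 hLSE).subvec (hS.posSemidef.smul hσ2.le) b₀
    simp_rw [← OracleHodges.score_colsIn] at hscore
    have hsub := (OracleHodges.tendstoNormal_leastSquares_iff_score (σ := σ) hεm hXb hSb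
      (OracleHodges.subvec b₀ β)).2 hscore
    simp_rw [OracleHodges.oracleLeastSquares, hsubmodel]
    exact hsub
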